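/- All graphs are finite and simple. Let $G$ be a graph with vertices $1,\dots,n$, adjacency matrix $A=A(G)$ and walk matrix $W(G)=[e,Ae,\dots,A^{n-1}e]$, where $e$ is the all-ones vector, and suppose that $G$ is controllable, i.e. $\operatorname{rank}W(G)=n$. A generalized cospectral mate of $G$ is a graph $H$, not isomorphic to $G$, such that $G$ and $H$ have the same spectrum and their complements have the same spectrum. Notation. For an integer $n\times n$ matrix $M$, $d_n(M)$ is the last invariant factor, i.e. the last diagonal entry of the Smith normal form of $M$. Let $J$ be the all-ones matrix, let $\chi(B;x)=\det(xI-B)$, and let $\chi(A;x)=x^n+c_1x^{n-1}+\dots+c_n$; let $\Delta(G)$ be the discriminant of $\chi(A;x)$. For a prime $p$ define a monic polynomial $M_p(x)$ over $\mathbb F_p$ as follows. If $p$ is odd, $$M_p(x)=\frac{\chi(A;x)}{\operatorname{sfp}\bigl(\gcd(\chi(A;x),\chi(A+J;x))\bigr)}$$ over $\mathbb F_p$, where $\operatorname{sfp}(f)$ is the product of the distinct monic irreducible factors of $f$. If $p=2$, $M_2(x)$ is the reduction modulo $2$ of $\sum_{i=0}^{\lfloor n/2\rfloor}c_{2i}x^{\lfloor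 n/2\rfloor-i}$ (with $c_0=1$) when $n$ is even, and of $x$ times this sum when $n$ is odd. Lift $M_p$ to the integer polynomial with coefficients in $\{0,\dots,p-1\}$, and let $s=\deg M_p$. The modified walk matrix is $$W^{(p)}(G)=\Bigl[e,Ae,\dots,A^{s-1}e,\tfrac{M_p(A)e}{p},\tfrac{AM_p(A)e}{p},\dots,\tfrac{A^{n-1-s}M_p(A)e}{p}\Bigr],$$ which is an integer matrix. Let $t_p=\operatorname{ord}_p\bigl(d_n(W^{(p)}(G))\bigr)$. The prime $2$ is called potential if $t_2\ge 1$; an odd prime $p$ is called potential if $t_p\ge1$, $p\mid\gcd(\Delta(G),d_n(W(G)))$ and $p^2\mid\Delta(G)$. Let $p_1,\dots,p_m$ be all the potential primes, put $t_i=t_{p_i}$ and $L=\prod_{i=1}^m p_i^{t_i}$ (so $L=1$ if there are none), and consider the system for integer vectors $x\in\mathbb Z^n$ $$(W^{(p_i)}(G))^{\mathsf T}x\equiv 0\pmod{p_i^{t_i}}\ (1\le i\le m),\qquad x^{\mathsf T}x=L^2,\qquad e^{\mathsf T}x=L,\qquad x^{\mathsf T}Ax=0.\tag{$*$}$$ A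 solution $x$ is called trivial if $x\equiv0\pmod L$, and nontrivial otherwise. Theorem. The controllable graph $G$ has a generalized cospectral mate if and only if the system $(*)$ has $n$ solutions $\xi_1,\dots,\xi_n$, not all trivial, such that $\xi_i^{\mathsf T}\xi_j=0$ and $\xi_i^{\mathsf T}A\xi_j\in\{0,L^2\}$ for all distinct $i$ and $j$. -/

import Mathlib

open scoped Matrix

namespace GenSpec

/-! ## Smith normal form of a square integer matrix -/

/-- `U * M * V = N` for some unimodular integer matrices `U`, `V`. -/
def MatEquiv {n : ℕ} (M N : Matrix (Fin n) (Fin n) ℤ) : Prop :=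
  ∃ U V : Matrix (Fin n) (Fin n) ℤ, IsUnit U ∧ IsUnit V ∧ U * M * V = N

/-- `diag(d 0, d 1, …)` is the Smith normal form of `M`: it is unimodularly equivalent to `M`, its
entries are natural numbers and each divides the next (so the zero entries, if any, come last). -/
def IsSmithNormalForm {n : ℕ} (M : Matrix (Fin n) (Fin n) ℤ) (d : Fin n → ℕ) : Prop :=
  MatEquiv M (Matrix.diagonal fun i => (d i : ℤ)) ∧ ∀ i j, i ≤ j → d i ∣ d j

theorem MatEquiv.refl {n : ℕ} (M : Matrix (Fin n) (Fin n) ℤ) : MatEquiv M M :=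
  ⟨1, 1, isUnit_one, isUnit_one, by simp⟩

theorem MatEquiv.trans {n : ℕ} {M N K : Matrix (Fin n) (Fin n) ℤ}
    (h : MatEquiv M N) (h' : MatEquiv N K) : MatEquiv M K := by
  obtain ⟨U, V, hU, hV, rfl⟩ := h
  obtain ⟨U', V', hU', hV', rfl⟩ := h'
  exact ⟨U' * U, V * V', hU'.mul hU, hV.mul hV', by simp only [Matrix.mul_assoc]⟩

theorem MatEquiv.transpose {n : ℕ} {M N : Matrix (Fin n) (Fin n) ℤ}
    (h : MatEquiv M N) : MatEquiv M.transpose N.transpose := by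
  obtain ⟨U, V, hU, hV, rfl⟩ := h
  refine ⟨V.transpose, U.transpose, ?_, ?_, by simp [Matrix.mul_assoc]⟩
  · rw [Matrix.isUnit_iff_isUnit_det] at *; simpa using hV
  · rw [Matrix.isUnit_iff_isUnit_det] at *; simpa using hU

/-- Adding multiples of row `k` to the other rows. -/
theorem MatEquiv.addRows {n : ℕ} (M : Matrix (Fin n) (Fin n) ℤ) (k : Fin n) (q : Fin n → ℤ)
    (hq : q k = 0) : MatEquiv M (M + Matrix.of fun i j => q i * M k j) := by
  have hinv : ∀ r : Fin n → ℤ, r k = 0 →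
      (1 + Matrix.vecMulVec r (Pi.single k 1)) * (1 + Matrix.vecMulVec (-r) (Pi.single k 1)) = 1 := by
    intro r hr
    simp [Matrix.mul_add, Matrix.add_mul, Matrix.vecMulVec_mul_vecMulVec, hr, Matrix.neg_vecMulVec]
  have hu : IsUnit (1 + Matrix.vecMulVec q (Pi.single k 1)) := by
    rw [Matrix.isUnit_iff_isUnit_det]
    exact Matrix.isUnit_det_of_right_inverse (hinv q hq)
  refine ⟨_, 1, hu, isUnit_one, ?_⟩
  ext i j
  simp [Matrix.add_mul, Matrix.vecMulVec_mul, Matrix.vecMulVec_apply]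

/-- Permuting rows and columns. -/
theorem MatEquiv.swap {n : ℕ} (M : Matrix (Fin n) (Fin n) ℤ) (e f : Equiv.Perm (Fin n)) :
    MatEquiv M (M.submatrix e f) := by
  refine ⟨e.toPEquiv.toMatrix, f.symm.toPEquiv.toMatrix, ?_, ?_, ?_⟩
  · rw [Matrix.isUnit_iff_isUnit_det]
    have := Matrix.det_permutation (R := ℤ) e
    rw [Equiv.Perm.permMatrix] at this
    rw [this]; exact Units.isUnit _
  · rw [Matrix.isUnit_iff_isUnit_det]
    have := Matrix.det_permutation (R := ℤ) f.symm
    rw [Equiv.Perm.permMatrix] at this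
    rw [this]; exact Units.isUnit _
  · rw [PEquiv.toMatrix_toPEquiv_mul, PEquiv.mul_toMatrix_toPEquiv]
    ext; simp

/-- The block matrix `diag(a, K)`. -/
def blk {n : ℕ} (a : ℤ) (K : Matrix (Fin n) (Fin n) ℤ) :
    Matrix (Fin (n + 1)) (Fin (n + 1)) ℤ :=
  Matrix.of fun i j => Fin.cases (Fin.cases a (fun _ => 0) j) (fun i' => Fin.cases 0 (K i') j) i

theorem blk_mul {n : ℕ} (a b : ℤ) (K K' : Matrix (Fin n) (Fin n) ℤ) :
    blk a K * blk b K' = blk (a * b) (K * K') := by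
  ext i j
  rw [Matrix.mul_apply, Fin.sum_univ_succ]
  refine Fin.cases ?_ (fun i' => ?_) i <;> refine Fin.cases ?_ (fun j' => ?_) j <;>
    simp [blk, Matrix.mul_apply]

theorem blk_one {n : ℕ} : blk (1 : ℤ) (1 : Matrix (Fin n) (Fin n) ℤ) = 1 := by
  ext i j
  refine Fin.cases ?_ (fun i' => ?_) i <;> refine Fin.cases ?_ (fun j' => ?_) j <;>
    simp [blk, Matrix.one_apply, Fin.succ_ne_zero, (Fin.succ_ne_zero _).symm]

theorem isUnit_blk {n : ℕ} {a : ℤ} {K : Matrix (Fin n) (Fin n) ℤ} (ha : IsUnit a)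
    (hK : IsUnit K) : IsUnit (blk a K) := by
  obtain ⟨b, hb⟩ := ha.exists_right_inv
  obtain ⟨K', hK'⟩ := hK.exists_right_inv
  rw [Matrix.isUnit_iff_isUnit_det]
  exact Matrix.isUnit_det_of_right_inverse (B := blk b K') (by rw [blk_mul, hb, hK', blk_one])

theorem dvd_col {n : ℕ} {M : Matrix (Fin (n + 1)) (Fin (n + 1)) ℤ} (h0 : M 0 0 ≠ 0)
    (hmin : ∀ N, MatEquiv M N → ∀ i j, N i j ≠ 0 → (M 0 0).natAbs ≤ (N i j).natAbs)
    (i : Fin (n + 1)) : M 0 0 ∣ M i 0 := by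
  by_cases hi : i = 0
  · rw [hi]
  have h := hmin _ (MatEquiv.addRows M 0 (Pi.single i (-(M i 0 / M 0 0)))
    (by rw [Pi.single_eq_of_ne (Ne.symm hi)])) i 0
  have he : (M + Matrix.of fun i' j => (Pi.single i (-(M i 0 / M 0 0)) : Fin (n + 1) → ℤ) i' * M 0 j)
      i 0 = M i 0 % M 0 0 := by
    simp [Int.emod_def]; ring
  rw [he] at h
  by_contra hd
  have h1 : M i 0 % M 0 0 ≠ 0 := fun h => hd (Int.dvd_of_emod_eq_zero h)
  have h2 := h h1
  have h3 := Int.emod_nonneg (M i 0) h0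
  have h4 := Int.emod_lt_abs (M i 0) h0
  rw [Int.abs_eq_natAbs] at h4
  omega

theorem dvd_row {n : ℕ} {M : Matrix (Fin (n + 1)) (Fin (n + 1)) ℤ} (h0 : M 0 0 ≠ 0)
    (hmin : ∀ N, MatEquiv M N → ∀ i j, N i j ≠ 0 → (M 0 0).natAbs ≤ (N i j).natAbs)
    (j : Fin (n + 1)) : M 0 0 ∣ M 0 j :=
  dvd_col (M := M.transpose) h0 (fun N hN i j h => hmin N.transpose
    (by simpa using hN.transpose) j i h) j

/-- Every square integer matrix has a Smith normal form. -/
theorem exists_isSmithNormalForm : ∀ {n : ℕ} (M : Matrix (Fin n) (Fin n) ℤ),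
    ∃ d, IsSmithNormalForm M d
  | 0, M => ⟨0, ⟨1, 1, isUnit_one, isUnit_one, by ext i; exact i.elim0⟩, fun i => i.elim0⟩
  | n + 1, M => by
    classical
    by_cases hM : M = 0
    · exact ⟨0, by simpa [hM] using MatEquiv.refl _, fun i j _ => dvd_rfl⟩
    -- an equivalent matrix whose top-left entry is nonzero of least absolute value
    obtain ⟨A, hMA, h0, hmin⟩ : ∃ A, MatEquiv M A ∧ A 0 0 ≠ 0 ∧
        ∀ N, MatEquiv A N → ∀ i j, N i j ≠ 0 → (A 0 0).natAbs ≤ (N i j).natAbs := by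
      have hex : ∃ k, ∃ N, MatEquiv M N ∧ ∃ i j, N i j ≠ 0 ∧ (N i j).natAbs = k := by
        obtain ⟨i, j, h⟩ : ∃ i j, M i j ≠ 0 := by
          by_contra! h
          exact hM (Matrix.ext h)
        exact ⟨_, M, MatEquiv.refl M, i, j, h, rfl⟩
      obtain ⟨N, hN, i, j, hij, hk⟩ := Nat.find_spec hex
      refine ⟨N.submatrix (Equiv.swap 0 i) (Equiv.swap 0 j), hN.trans (MatEquiv.swap _ _ _),
        by simpa using hij, fun N' hN' i' j' h' => ?_⟩
      have := Nat.find_min' hex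
        ⟨N', (hN.trans (MatEquiv.swap _ _ _)).trans hN', i', j', h', rfl⟩
      simpa [hk] using this
    -- clear the first column, then the first row
    have key : ∀ A : Matrix (Fin (n + 1)) (Fin (n + 1)) ℤ, (∀ i, A 0 0 ∣ A i 0) →
        ∃ B, MatEquiv A B ∧ (∀ j, B 0 j = A 0 j) ∧ ∀ i, i ≠ 0 → B i 0 = 0 := by
      intro A hA
      refine ⟨_, MatEquiv.addRows A 0 (fun i => if i = 0 then 0 else -(A i 0 / A 0 0)) (by simp),
        fun j => by simp, fun i hi => ?_⟩
      simp [hi, Int.ediv_mul_cancel (hA i)]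
    obtain ⟨B, hAB, hB0, hBc⟩ := key A (dvd_col h0 hmin)
    obtain ⟨C, hBC, hC0, hCc⟩ := key B.transpose (fun i => by
      simpa [hB0] using dvd_row h0 hmin i)
    have hAC : MatEquiv A C.transpose := hAB.trans (by simpa using hBC.transpose)
    obtain ⟨D, hD⟩ : ∃ D, D = C.transpose := ⟨_, rfl⟩
    rw [← hD] at hAC
    have hD00 : D 0 0 = A 0 0 := by simp [hD, hC0, hB0]
    have hDr : ∀ j : Fin n, D 0 j.succ = 0 := fun j => by
      simp [hD, hCc _ (Fin.succ_ne_zero j)]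
    have hDc : ∀ i : Fin n, D i.succ 0 = 0 := fun i => by
      simp [hD, hC0, hBc _ (Fin.succ_ne_zero i)]
    have hDmin : ∀ N, MatEquiv D N → ∀ i j, N i j ≠ 0 → (D 0 0).natAbs ≤ (N i j).natAbs := by
      intro N hN
      rw [hD00]
      exact hmin N (hAC.trans hN)
    have hDK : D = blk (D 0 0) (D.submatrix Fin.succ Fin.succ) := by
      ext i j
      refine Fin.cases ?_ (fun i' => ?_) i <;> refine Fin.cases ?_ (fun j' => ?_) j <;>
        simp [blk, hDr, hDc]
    have hdvd : ∀ i j : Fin n, D 0 0 ∣ D i.succ j.succ := by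
      intro i j
      have hE := MatEquiv.addRows D i.succ (Pi.single 0 1)
        (Pi.single_eq_of_ne (Fin.succ_ne_zero i) _)
      obtain ⟨E, hEdef⟩ : ∃ E, E = D + Matrix.of fun i' j' =>
        (Pi.single 0 1 : Fin (n + 1) → ℤ) i' * D i.succ j' := ⟨_, rfl⟩
      rw [← hEdef] at hE
      have hE0 : E 0 0 = D 0 0 := by simp [hEdef, hDc]
      have := dvd_row (M := E) (by rw [hE0, hD00]; exact h0)
        (fun N hN => by rw [hE0]; exact hDmin N (hE.trans hN)) j.succ
      rw [hE0] at this
      simpa [hEdef, hDr] using this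
    obtain ⟨d, ⟨U, V, hU, hV, hUV⟩, hd⟩ :=
      exists_isSmithNormalForm (D.submatrix Fin.succ Fin.succ)
    have hdd : ∀ i, (D 0 0).natAbs ∣ d i := by
      intro i
      have h : (d i : ℤ) = (U * D.submatrix Fin.succ Fin.succ * V) i i := by rw [hUV]; simp
      rw [← Int.natCast_dvd_natCast, h, Int.natAbs_dvd]
      simp only [Matrix.mul_apply, Matrix.submatrix_apply]
      exact Finset.dvd_sum fun k _ => Dvd.dvd.mul_right
        (Finset.dvd_sum fun l _ => Dvd.dvd.mul_left (hdvd l k) _) _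
    obtain ⟨u, hu, hua⟩ : ∃ u : ℤ, IsUnit u ∧ u * D 0 0 = ((D 0 0).natAbs : ℤ) := by
      rcases Int.natAbs_eq (D 0 0) with h | h
      · exact ⟨1, isUnit_one, by omega⟩
      · exact ⟨-1, isUnit_one.neg, by omega⟩
    refine ⟨Fin.cons (D 0 0).natAbs d, (hMA.trans hAC).trans
      ⟨blk u U, blk 1 V, isUnit_blk hu hU, isUnit_blk isUnit_one hV, ?_⟩, ?_⟩
    · rw [hDK, blk_mul, blk_mul, hUV, hua]
      ext i j
      refine Fin.cases ?_ (fun i' => ?_) i <;> refine Fin.cases ?_ (fun j' => ?_) j <;>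
        simp [blk, Matrix.diagonal_apply, Fin.succ_ne_zero, (Fin.succ_ne_zero _).symm]
    · intro i j
      refine Fin.cases ?_ (fun i' => ?_) i <;> refine Fin.cases ?_ (fun j' => ?_) j
      · simp
      · intro _; simpa using hdd j'
      · intro h; exact absurd h (by simp)
      · intro h; simpa using hd i' j' (Fin.succ_le_succ_iff.mp h)
/-- The `k`-th invariant factor `d_k(M)`, `1 ≤ k ≤ n`, of an integer `n × n` matrix `M`, i.e. the
`k`-th diagonal entry of its (unique) Smith normal form. The value outside this range is `1`. -/
noncomputable def invariantFactor {n : ℕ} (M : Matrix (Fin n) (Fin n) ℤ) (k : ℕ) : ℕ :=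
  if h : 1 ≤ k ∧ k ≤ n then (exists_isSmithNormalForm M).choose ⟨k - 1, by omega⟩ else 1

/-! ## Spectra, walk matrices, controllability -/

open scoped Classical in
/-- The adjacency matrix of `G` over `R`. -/
noncomputable def adj {n : ℕ} (R : Type*) [Zero R] [One R] (G : SimpleGraph (Fin n)) :
    Matrix (Fin n) (Fin n) R :=
  G.adjMatrix R

/-- The spectrum of `G`: the multiset of eigenvalues of its adjacency matrix. -/
noncomputable def spec {n : ℕ} (G : SimpleGraph (Fin n)) : Multiset ℂ :=
  (adj ℂ G).charpoly.roots

/-- `G` and `H` have the same spectrum, and so have their complements. -/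
def GeneralizedCospectral {n m : ℕ} (G : SimpleGraph (Fin n)) (H : SimpleGraph (Fin m)) : Prop :=
  spec G = spec H ∧ spec Gᶜ = spec Hᶜ

/-- `H` is generalized cospectral with `G` but not isomorphic to `G`. -/
def IsGeneralizedCospectralMate {n m : ℕ} (G : SimpleGraph (Fin n)) (H : SimpleGraph (Fin m)) :
    Prop :=
  GeneralizedCospectral G H ∧ IsEmpty (G ≃g H)

/-- `G` has a generalized cospectral mate; every finite graph is, up to isomorphism, a graph on
some `Fin m`. -/
def HasGeneralizedCospectralMate {n : ℕ} (G : SimpleGraph (Fin n)) : Prop :=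
  ∃ (m : ℕ) (H : SimpleGraph (Fin m)), IsGeneralizedCospectralMate G H

/-- The walk matrix `W(G) = [e, Ae, …, A^(n-1) e]`. -/
noncomputable def walkMatrix {n : ℕ} (G : SimpleGraph (Fin n)) : Matrix (Fin n) (Fin n) ℤ :=
  Matrix.of fun i j => ((adj ℤ G ^ (j : ℕ)) *ᵥ 1) i

/-- `G` is controllable: `rank W(G) = n`. -/
def Controllable {n : ℕ} (G : SimpleGraph (Fin n)) : Prop :=
  ((walkMatrix G).map (Int.cast : ℤ → ℚ)).rank = n

/-! ## The polynomials `M_p` and the modified walk matrices -/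

/-- Primality as an instance, so that `ZMod p` is a field for `p : Nat.Primes`. -/
instance factPrime (p : Nat.Primes) : Fact (p : ℕ).Prime := ⟨p.2⟩

/-- `χ(G; x) / sfp(gcd(χ(A; x), χ(A + J; x)))` over the field with `p` elements, where `sfp`, the
square-free part, is the product of the distinct monic irreducible factors (Mathlib's `radical`).
The division is exact. -/
noncomputable def mainPoly {n : ℕ} (G : SimpleGraph (Fin n)) (p : Nat.Primes) :
    Polynomial (ZMod p) :=
  (adj (ZMod p) G).charpoly /
    UniqueFactorizationMonoid.radical (EuclideanDomain.gcd (adj (ZMod p) G).charpoly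
      (adj (ZMod p) G + Matrix.of fun _ _ => 1).charpoly)

/-- With `χ(G; x) = x^n + c_1 x^(n-1) + ⋯ + c_n` and `k = ⌊n/2⌋`, this is
`ψ(x) = ∑_{i ≤ k} c_{2i} x^(k-i)` if `n` is even, and `x` times this sum if `n` is odd. -/
noncomputable def psi {n : ℕ} (G : SimpleGraph (Fin n)) : Polynomial ℤ :=
  (if Even n then 1 else Polynomial.X) *
    ∑ i ∈ Finset.range (n / 2 + 1),
      Polynomial.C ((adj ℤ G).charpoly.coeff (n - 2 * i)) * Polynomial.X ^ (n / 2 - i)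

/-- `M_p(G; x)` as a polynomial over the field with `p` elements. -/
noncomputable def Mbar {n : ℕ} (G : SimpleGraph (Fin n)) (p : Nat.Primes) :
    Polynomial (ZMod p) :=
  if (p : ℕ) = 2 then (psi G).map (Int.castRingHom (ZMod p)) else mainPoly G p

/-- `M_p(G; x)` as an integer polynomial with all coefficients in `{0, …, p - 1}`. -/
noncomputable def Mpoly {n : ℕ} (G : SimpleGraph (Fin n)) (p : Nat.Primes) : Polynomial ℤ :=
  ∑ i ∈ Finset.range ((Mbar G p).natDegree + 1),
    Polynomial.C (((Mbar G p).coeff i).val : ℤ) * Polynomial.X ^ i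

/-- The modified walk matrix `W^(p)(G)`, with columns `e, Ae, …, A^(s-1) e` followed by
`M_p(A)e / p, A M_p(A)e / p, …, A^(n-1-s) M_p(A)e / p`, where `s = deg M_p`. The entries of
`M_p(A)e` are multiples of `p`, so the integer division is exact. -/
noncomputable def modifiedWalkMatrix {n : ℕ} (G : SimpleGraph (Fin n)) (p : Nat.Primes) :
    Matrix (Fin n) (Fin n) ℤ :=
  Matrix.of fun i j =>
    if (j : ℕ) < (Mpoly G p).natDegree then ((adj ℤ G ^ (j : ℕ)) *ᵥ 1) i
    else ((adj ℤ G ^ ((j : ℕ) - (Mpoly G p).natDegree) *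
      Polynomial.aeval (adj ℤ G) (Mpoly G p)) *ᵥ 1) i / (p : ℤ)

/-! ## Potential primes, the number `L` and the system of equations -/

/-- The discriminant of the characteristic polynomial of `G`. -/
noncomputable def graphDiscr {n : ℕ} (G : SimpleGraph (Fin n)) : ℤ :=
  (adj ℤ G).charpoly.discr

/-- The exponent `t_p = ord_p(d_n(W^(p)(G)))`. -/
noncomputable def texp {n : ℕ} (G : SimpleGraph (Fin n)) (p : Nat.Primes) : ℕ :=
  padicValNat p (invariantFactor (modifiedWalkMatrix G p) n)

/-- The prime `p` is potential: `t_p ≥ 1` and, if `p` is odd, moreover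
`p ∣ gcd(Δ(G), d_n(W(G)))` and `p ^ 2 ∣ Δ(G)`. -/
def IsPotential {n : ℕ} (G : SimpleGraph (Fin n)) (p : Nat.Primes) : Prop :=
  1 ≤ texp G p ∧ ((p : ℕ) ≠ 2 →
    (p : ℕ) ∣ Int.gcd (graphDiscr G) (invariantFactor (walkMatrix G) n) ∧
      ((p : ℕ) : ℤ) ^ 2 ∣ graphDiscr G)

/-- `L = ∏ p ^ t_p` over all potential primes `p`. For controllable `G` these are finitely many,
since an odd one divides `d_n(W(G)) ≠ 0`. -/
noncomputable def level {n : ℕ} (G : SimpleGraph (Fin n)) : ℕ :=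
  ∏ᶠ (p : Nat.Primes) (_ : IsPotential G p), (p : ℕ) ^ texp G p

/-- `x` is an integral solution of the system
`W^(p)(G)ᵀ x ≡ 0 (mod p ^ t_p)` for all potential primes `p`,
`xᵀ x = L ^ 2`, `eᵀ x = L`, `xᵀ A(G) x = 0`. -/
def IsSolution {n : ℕ} (G : SimpleGraph (Fin n)) (x : Fin n → ℤ) : Prop :=
  (∀ p : Nat.Primes, IsPotential G p →
    ∀ j, ((p : ℕ) : ℤ) ^ texp G p ∣ ((modifiedWalkMatrix G p)ᵀ *ᵥ x) j) ∧
  x ⬝ᵥ x = (level G : ℤ) ^ 2 ∧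
  1 ⬝ᵥ x = (level G : ℤ) ∧
  x ⬝ᵥ (adj ℤ G *ᵥ x) = 0

/-- `x` is nontrivial: `x ≢ 0 (mod L)`. -/
def IsNontrivial {n : ℕ} (G : SimpleGraph (Fin n)) (x : Fin n → ℤ) : Prop :=
  ¬ ∀ v, (level G : ℤ) ∣ x v

end GenSpec

namespace GenSpec

open Polynomial

/-! ### Adjugates of singular symmetric matrices and of `xI - A`. -/

section Adjugate

variable {ι : Type*} [Fintype ι] [DecidableEq ι]

/-! Write `A`, `B` for the adjacency matrices of `G`, `H`. If `H` is generalized cospectral with the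
controllable graph `G`, then `Q = W(G) W(H)⁻¹` is a rational orthogonal matrix with `Qᵀ A Q = B` and
`Qᵀ e = e` (`GeneralizedCospectral.exists_orthogonal`). The solutions sought are the columns of `L
Q`. The work lies in showing that `L Q` is integral, that is, that the least common denominator of
`Q` divides `L` (`den_dvd_level`).

This is checked one prime power at a time. The polynomial `M_p` depends only on the generalized
spectrum, so `W^(p)(G)ᵀ Q = W^(p)(H)ᵀ` is integral. Since `d_n` times the inverse of `W^(p)(G)` is
also integral, `p ^ k ∣ den Q` forces `k ≤ t_p`. It remains to see that such a `p` is potential. The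
ordinary walk matrix gives `p ∣ d_n(W(G))` in the same way. For `p² ∣ Δ(G)`, reduce `den Q · Q`
modulo `p`: its column space is nonzero, `A`-invariant and totally isotropic, so over the algebraic
closure it contains an isotropic eigenvector. Its eigenvalue is a root of `χ'`, so `χ'(A)`, whose
determinant is `±Δ(G)`, is singular on an isotropic space, and this yields two factors `p`.

The matrices `W^(p)` are integral because `M_p(A) e ≡ 0 (mod p)` (`Mbar_spec`). For odd `p` this
holds because `χ(A) - χ(A + J) = eᵀ adj(xI - A) e`, and at a common root the adjugate is symmetric
of rank at most one. For `p = 2`, `M_2²` is a multiple of `χ`, and over `F_2` a symmetric matrix of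
square zero annihilates `e`.

Conversely, the solutions divided by `L` are the columns of an orthogonal matrix fixing `e` that
carries `A` to the adjacency matrix of some `H`. An isomorphism `G ≃g H` would, by controllability,
make that matrix a permutation matrix and every solution trivial. -/

theorem adjugate_apply_mul_of_mulVec_eq_zero {R : Type*} [CommRing R] [IsDomain R]
    {M : Matrix ι ι R} {v : ι → R} (hv : v ≠ 0) (h : M *ᵥ v = 0) (i j k : ι) :
    M.adjugate i j * v k = M.adjugate k j * v i := by
  -- The new row `j` is chosen orthogonal to `v`, so the modified matrix still annihilates `v`;
  -- linearity in that row turns its determinant into the claimed difference.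
  have hz : (M.updateRow j (v k • Pi.single i 1 - v i • Pi.single k 1)).det = 0 := by
    rw [← Matrix.exists_mulVec_eq_zero_iff]
    refine ⟨v, hv, ?_⟩
    ext l
    by_cases hl : l = j
    · subst hl
      rw [Matrix.mulVec, Matrix.updateRow_self]
      change (v k • Pi.single i 1 - v i • Pi.single k 1 : ι → R) ⬝ᵥ v = 0
      rw [sub_dotProduct, smul_dotProduct, smul_dotProduct]
      simp [mul_comm]
    · simpa [Matrix.mulVec, hl] using congrFun h l
  rw [sub_eq_add_neg, Matrix.det_updateRow_add, ← neg_smul, Matrix.det_updateRow_smul,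
    Matrix.det_updateRow_smul, ← Matrix.adjugate_apply, ← Matrix.adjugate_apply] at hz
  linear_combination hz

theorem exists_adjugate_eq_vecMulVec {K : Type*} [Field K] {M : Matrix ι ι K} {v : ι → K}
    (hv : v ≠ 0) (h : M *ᵥ v = 0) : ∃ w, M.adjugate = Matrix.vecMulVec v w := by
  obtain ⟨k, hk⟩ := Function.ne_iff.mp hv
  refine ⟨fun j => M.adjugate k j / v k, ?_⟩
  ext i j
  rw [Matrix.vecMulVec_apply]
  have := adjugate_apply_mul_of_mulVec_eq_zero hv h i j k
  simp only [Pi.zero_apply] at hk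
  field_simp
  linear_combination this

/-- A singular symmetric matrix has an adjugate of rank at most one, so the quadratic form of the
adjugate vanishes only on its kernel. -/
theorem adjugate_mulVec_eq_zero {K : Type*} [Field K] {M : Matrix ι ι K} (hM : M.IsSymm)
    (hdet : M.det = 0) (u : ι → K) (hu : u ⬝ᵥ (M.adjugate *ᵥ u) = 0) :
    M.adjugate *ᵥ u = 0 := by
  obtain ⟨v, hv, h⟩ := Matrix.exists_mulVec_eq_zero_iff.mpr hdet
  obtain ⟨w, hw⟩ := exists_adjugate_eq_vecMulVec hv h
  have hw' : M.adjugate = Matrix.vecMulVec w v := by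
    rw [← hM.adjugate.eq, hw, Matrix.transpose_vecMulVec]
  have h1 : (u ⬝ᵥ v) * (w ⬝ᵥ u) = 0 := by
    rw [← hu, hw, Matrix.vecMulVec_mulVec]
    simp [mul_comm]
  rcases mul_eq_zero.mp h1 with h2 | h2
  · rw [hw', Matrix.vecMulVec_mulVec, dotProduct_comm, h2]; simp
  · rw [hw, Matrix.vecMulVec_mulVec, h2]; simp

/-- The adjugate is `v wᵀ` and, by symmetry, also `w vᵀ`. Applied to `v`, these give `(w ⬝ v) v = (v
⬝ v) w = 0`, and `w ⬝ v` is the trace. -/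
theorem trace_adjugate_eq_zero {K : Type*} [Field K] {M : Matrix ι ι K} (hM : M.IsSymm)
    {v : ι → K} (hv : v ≠ 0) (h : M *ᵥ v = 0) (hvv : v ⬝ᵥ v = 0) : M.adjugate.trace = 0 := by
  obtain ⟨w, hw⟩ := exists_adjugate_eq_vecMulVec hv h
  have hw' : M.adjugate = Matrix.vecMulVec w v := by
    rw [← hM.adjugate.eq, hw, Matrix.transpose_vecMulVec]
  have h1 : M.adjugate *ᵥ v = 0 := by
    rw [hw', Matrix.vecMulVec_mulVec, hvv]; simp
  rw [hw, Matrix.vecMulVec_mulVec] at h1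
  rw [hw, Matrix.trace_vecMulVec]
  obtain ⟨k, hk⟩ := Function.ne_iff.mp hv
  have h2 := congrFun h1 k
  simp only [Pi.smul_apply, MulOpposite.smul_eq_mul_unop, MulOpposite.unop_op, Pi.zero_apply,
    mul_eq_zero] at h2 hk
  rw [dotProduct_comm]
  exact h2.resolve_left hk

/-- The matrix determinant lemma without inverses, proved in the fraction field so that it applies
to `xI - A`. -/
theorem det_add_vecMulVec {R : Type*} [CommRing R] [IsDomain R] {M : Matrix ι ι R}
    (hM : M.det ≠ 0) (u v : ι → R) :
    (M + Matrix.vecMulVec u v).det = M.det + v ⬝ᵥ (M.adjugate *ᵥ u) := by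
  have key : ∀ {K : Type _} [Field K] {M : Matrix ι ι K} (_ : M.det ≠ 0) (u v : ι → K),
      (M + Matrix.vecMulVec u v).det = M.det + v ⬝ᵥ (M.adjugate *ᵥ u) := by
    intro K _ M hM u v
    rw [Matrix.vecMulVec_eq Unit, Matrix.det_add_replicateCol_mul_replicateRow hM.isUnit,
      Matrix.det_unique (n := Unit), Matrix.add_apply, Matrix.one_apply_eq, Matrix.mul_assoc]
    have h : (Matrix.replicateRow Unit v * (M⁻¹ * Matrix.replicateCol Unit u)) default default =
        v ⬝ᵥ (M⁻¹ *ᵥ u) := by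
      rw [← Matrix.replicateCol_mulVec, Matrix.replicateRow_mul_replicateCol_apply]
    rw [h, Matrix.inv_def, Matrix.smul_mulVec, dotProduct_smul, Ring.inverse_eq_inv', smul_eq_mul,
      mul_add, mul_one, mul_inv_cancel_left₀ hM]
  have hf := IsFractionRing.injective R (FractionRing R)
  apply hf
  have h := key (M := (algebraMap R (FractionRing R)).mapMatrix M)
    (by rw [← RingHom.map_det]; exact (map_ne_zero_iff _ hf).mpr hM)
    (algebraMap R (FractionRing R) ∘ u) (algebraMap R (FractionRing R) ∘ v)
  rw [← RingHom.map_adjugate, ← RingHom.map_det] at h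
  have h2 : algebraMap R (FractionRing R) ∘ (M.adjugate *ᵥ u) =
      (algebraMap R (FractionRing R)).mapMatrix M.adjugate *ᵥ (algebraMap R (FractionRing R) ∘ u) :=
    funext (RingHom.map_mulVec _ _ _)
  rw [RingHom.map_det, map_add, map_add, RingHom.map_dotProduct, h2, ← h]
  congr 2
  ext i j
  simp [Matrix.vecMulVec_apply]

/-- Product rule on the Leibniz expansion: differentiating column `i` of `xI - A` leaves the `i`-th
basis vector, so the `i`-th term is a principal cofactor. -/
theorem derivative_charpoly {R : Type*} [CommRing R] (A : Matrix ι ι R) :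
    derivative A.charpoly = (A.charmatrix.adjugate).trace := by
  have h : ∀ i, A.charmatrix.adjugate i i = ∑ σ : Equiv.Perm ι, Equiv.Perm.sign σ •
      ((∏ b ∈ Finset.univ.erase i, A.charmatrix (σ b) b) * derivative (A.charmatrix (σ i) i)) := by
    intro i
    rw [← Matrix.transpose_apply A.charmatrix.adjugate i i, Matrix.adjugate_transpose,
      Matrix.adjugate_apply, Matrix.updateRow_transpose, Matrix.det_transpose,
      Matrix.det_apply]
    refine Finset.sum_congr rfl fun σ _ => ?_
    congr 1
    rw [← Finset.prod_erase_mul _ _ (Finset.mem_univ i)]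
    congr 1
    · refine Finset.prod_congr rfl fun b hb => ?_
      rw [Matrix.updateCol_ne (Finset.ne_of_mem_erase hb)]
    · by_cases hi : σ i = i
      · simp [hi]
      · simp [hi]
  rw [Matrix.charpoly, Matrix.det_apply, derivative_sum, Matrix.trace]
  simp only [Matrix.diag_apply, h]
  rw [Finset.sum_comm]
  refine Finset.sum_congr rfl fun σ _ => ?_
  rw [Units.smul_def, derivative_smul, derivative_prod_finset, ← Finset.smul_sum]
  rfl

theorem eval_adjugate_charmatrix {R : Type*} [CommRing R] (A : Matrix ι ι R) (t : R) :
    A.charmatrix.adjugate.map (eval t) = (Matrix.scalar ι t - A).adjugate := by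
  have h := (evalRingHom t).map_adjugate A.charmatrix
  have h2 : (evalRingHom t).mapMatrix A.charmatrix = Matrix.scalar ι t - A := by
    ext i j
    obtain rfl | hij := eq_or_ne i j <;> simp [*]
  rw [h2] at h
  exact h

/-- `adj(xI - A) = ∑ₖ xᵏ ∑_{j > k} c_j A^(j-k-1)` where `χ(A; x) = ∑ c_j xʲ`. -/
theorem coeff_adjugate_charmatrix {R : Type*} [CommRing R] (A : Matrix ι ι R) :
    ∃ B, ∀ m ≥ B, ∀ k, A.charmatrix.adjugate.map (coeff · k) =
      ∑ i ∈ Finset.range m, A.charpoly.coeff (k + 1 + i) • A ^ i := by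
  have hrec : ∀ k, A.charmatrix.adjugate.map (coeff · k) =
      A * A.charmatrix.adjugate.map (coeff · (k + 1)) + A.charpoly.coeff (k + 1) • 1 := by
    intro k
    have h := Matrix.mul_adjugate A.charmatrix
    generalize A.charmatrix.adjugate = N at h ⊢
    rw [← Matrix.charpoly, Matrix.charmatrix] at h
    ext i j
    have h1 := congrArg (fun M => (M i j).coeff (k + 1)) h
    simp only [Matrix.sub_mul, Matrix.sub_apply, coeff_sub, Matrix.smul_apply, smul_eq_mul,
      Matrix.scalar_apply, Matrix.diagonal_mul, coeff_X_mul] at h1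
    simp only [Matrix.mul_apply, finsetSum_coeff, RingHom.mapMatrix_apply, Matrix.map_apply,
      coeff_C_mul] at h1
    rw [sub_eq_iff_eq_add'] at h1
    simp only [Matrix.add_apply, Matrix.smul_apply, Matrix.map_apply, Matrix.mul_apply, smul_eq_mul,
      h1]
    obtain rfl | hij := eq_or_ne i j <;> simp [*]
  have hexp : ∀ m k, A.charmatrix.adjugate.map (coeff · k) =
      ∑ i ∈ Finset.range m, A.charpoly.coeff (k + 1 + i) • A ^ i +
        A ^ m * A.charmatrix.adjugate.map (coeff · (k + m)) := by
    intro m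
    induction m with
    | zero => intro k; simp
    | succ m ih =>
      intro k
      rw [ih k, Finset.sum_range_succ, hrec (k + m), Matrix.mul_add, ← Matrix.mul_assoc, ← pow_succ]
      simp only [Matrix.mul_smul, Matrix.mul_one]
      rw [show k + (m + 1) = k + m + 1 by ring, show k + 1 + m = k + m + 1 by ring]
      abel
  generalize A.charmatrix.adjugate = N at hexp ⊢
  refine ⟨(Finset.univ.sup fun ij : ι × ι => (N ij.1 ij.2).natDegree) + 1, fun m hm k => ?_⟩
  rw [hexp _ k, add_eq_left]
  convert Matrix.mul_zero _
  ext i j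
  refine coeff_eq_zero_of_natDegree_lt ?_
  have := Finset.le_sup (f := fun ij : ι × ι => (N ij.1 ij.2).natDegree) (Finset.mem_univ (i, j))
  simp only at this
  omega

end Adjugate

/-! ### Polynomials in `A` that annihilate a given vector. -/

section Annihilators

variable {ι : Type*} [Fintype ι] [DecidableEq ι]

theorem map_aeval_matrix {R S : Type*} [CommRing R] [CommRing S] (f : R →+* S) (A : Matrix ι ι R)
    (p : R[X]) : (aeval A p).map f = aeval (A.map f) (p.map f) := by
  change f.mapMatrix (aeval A p) = aeval (f.mapMatrix A) (p.map f)
  rw [aeval_def, aeval_def, hom_eval₂, eval₂_map]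
  congr 1
  ext r i j
  simp [Matrix.algebraMap_matrix_apply, apply_ite f]

/-- Synthetic division: in the expansion of `adj(xI - A)` at `x = θ`, the coefficient of `A^i` is `∑
θ^k c_(k+1+i)`, which telescopes to the `i`-th coefficient of `q = χ / (X - θ)`. -/
theorem aeval_eq_adjugate {K : Type*} [Field K] {A : Matrix ι ι K} {θ : K} {q : K[X]}
    (h : A.charpoly = (X - C θ) * q) : aeval A q = (Matrix.scalar ι θ - A).adjugate := by
  obtain ⟨B, hB⟩ := coeff_adjugate_charmatrix A
  have hc : ∀ i D, q.natDegree < D →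
      ∑ k ∈ Finset.range D, θ ^ k * A.charpoly.coeff (k + 1 + i) = q.coeff i := by
    intro i D hD
    have h1 : ∀ k, θ ^ k * A.charpoly.coeff (k + 1 + i) =
        θ ^ k * q.coeff (k + i) - θ ^ (k + 1) * q.coeff (k + 1 + i) := by
      intro k
      rw [h, show k + 1 + i = k + i + 1 by ring, sub_mul, coeff_sub, coeff_X_mul, coeff_C_mul]
      ring
    simp only [h1]
    rw [Finset.sum_range_sub', coeff_eq_zero_of_natDegree_lt (n := D + i) (by omega)]
    simp
  rw [← eval_adjugate_charmatrix, aeval_eq_sum_range' (n := max B (q.natDegree + 1)) (by omega)]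
  specialize hB (max B (q.natDegree + 1)) (le_max_left _ _)
  generalize A.charmatrix.adjugate = N at hB ⊢
  ext i j
  have hD := Finset.le_sup (f := fun ij : ι × ι => (N ij.1 ij.2).natDegree)
    (Finset.mem_univ (i, j))
  simp only at hD
  set d := Finset.univ.sup (fun ij : ι × ι => (N ij.1 ij.2).natDegree)
  rw [Matrix.map_apply, eval_eq_sum_range' (n := max d q.natDegree + 1) (by omega)]
  have h2 : ∀ k, (N i j).coeff k = ∑ l ∈ Finset.range (max B (q.natDegree + 1)),
      A.charpoly.coeff (k + 1 + l) * (A ^ l) i j := by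
    intro k
    have := congrFun (congrFun (hB k) i) j
    simpa [Matrix.sum_apply] using this
  simp only [h2, Finset.sum_mul]
  rw [Finset.sum_comm, Matrix.sum_apply]
  refine Finset.sum_congr rfl fun l _ => ?_
  rw [Matrix.smul_apply, smul_eq_mul, ← hc l (max d q.natDegree + 1) (by omega), Finset.sum_mul]
  exact Finset.sum_congr rfl fun k _ => by ring

theorem mapMatrix_aeval_charmatrix {F K : Type*} [Field F] [Field K] [Algebra F K]
    (A : Matrix ι ι F) (θ : K) :
    (aeval θ : F[X] →ₐ[F] K).toRingHom.mapMatrix A.charmatrix =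
      Matrix.scalar ι θ - A.map (algebraMap F K) := by
  ext i j
  obtain rfl | hij := eq_or_ne i j <;> simp [*]

/-- If an irreducible factor `π` of `χ(A; x) = π c` also divides `uᵀ adj(xI - A) u`, where `A` is
symmetric, then `c(A) u = 0`. -/
theorem aeval_mulVec_eq_zero_of_irreducible {F : Type*} [Field F] {A : Matrix ι ι F}
    (hA : A.IsSymm) (u : ι → F) {π c : F[X]} (hπ : Irreducible π) (hc : A.charpoly = π * c)
    (hφ : π ∣ (C ∘ u) ⬝ᵥ (A.charmatrix.adjugate *ᵥ (C ∘ u))) : aeval A c *ᵥ u = 0 := by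
  let K := AlgebraicClosure F
  obtain ⟨θ, hθ⟩ := IsAlgClosed.exists_aeval_eq_zero K π hπ.degree_pos.ne'
  obtain ⟨ρ, hρ⟩ : (X - C θ) ∣ π.map (algebraMap F K) := by
    rw [dvd_iff_isRoot, IsRoot, eval_map_algebraMap, hθ]
  set A' := A.map (algebraMap F K) with hA'
  have hchar : A'.charpoly = (X - C θ) * (ρ * c.map (algebraMap F K)) := by
    rw [hA', ← RingHom.mapMatrix_apply, RingHom.mapMatrix_apply, Matrix.charpoly_map, hc,
      Polynomial.map_mul, hρ, mul_assoc]
  have hsymm : (Matrix.scalar ι θ - A').IsSymm :=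
    (by simp [Matrix.IsSymm] : (Matrix.scalar ι θ).IsSymm).sub (hA.map _)
  have hdet : (Matrix.scalar ι θ - A').det = 0 := by
    rw [← Matrix.eval_charpoly, hchar]; simp
  have hform : (algebraMap F K ∘ u) ⬝ᵥ ((Matrix.scalar ι θ - A').adjugate *ᵥ
      (algebraMap F K ∘ u)) = 0 := by
    obtain ⟨d, hd⟩ := hφ
    have h1 := congrArg (aeval θ : F[X] →ₐ[F] K).toRingHom hd
    rw [map_mul, RingHom.map_dotProduct] at h1
    have h2 : (aeval θ : F[X] →ₐ[F] K).toRingHom ∘ (A.charmatrix.adjugate *ᵥ (C ∘ u)) =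
        (aeval θ : F[X] →ₐ[F] K).toRingHom.mapMatrix A.charmatrix.adjugate *ᵥ
          ((aeval θ : F[X] →ₐ[F] K).toRingHom ∘ C ∘ u) := funext (RingHom.map_mulVec _ _ _)
    have h3 : (aeval θ : F[X] →ₐ[F] K).toRingHom ∘ C ∘ u = algebraMap F K ∘ u := by
      ext i; simp
    have h4 : (aeval θ : F[X] →ₐ[F] K).toRingHom π = 0 := hθ
    rw [h2, h3, RingHom.map_adjugate, mapMatrix_aeval_charmatrix, h4, zero_mul] at h1
    exact h1
  have hq := adjugate_mulVec_eq_zero hsymm hdet _ hform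
  rw [← aeval_eq_adjugate hchar] at hq
  set y := aeval A c *ᵥ u with hy
  have hmap : ∀ f : F[X], aeval A' (f.map (algebraMap F K)) = (aeval A f).map (algebraMap F K) :=
    fun f => (map_aeval_matrix _ A f).symm
  have hρy : aeval A' ρ *ᵥ (algebraMap F K ∘ y) = 0 := by
    rw [map_mul, ← Matrix.mulVec_mulVec, hmap] at hq
    rwa [show algebraMap F K ∘ y = (aeval A c).map (algebraMap F K) *ᵥ (algebraMap F K ∘ u) from
      funext (RingHom.map_mulVec _ _ _)]
  have hρ0 : ρ.natDegree < π.natDegree := by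
    have := congrArg natDegree hρ
    have hne : ρ ≠ 0 := by
      rintro rfl
      simp [hπ.ne_zero] at hρ
    rw [natDegree_map, natDegree_mul (X_sub_C_ne_zero θ) hne, natDegree_X_sub_C] at this
    omega
  have hlead : ρ.leadingCoeff ≠ 0 := by
    rw [leadingCoeff_ne_zero]
    rintro rfl
    simp [hπ.ne_zero] at hρ
  -- Descent to `F`: since `A` and `y` are defined over `F`, applying an `F`-linear functional to
  -- the coefficients of `ρ` preserves the relation `ρ(A) y = 0`. The result `r` is nonzero of
  -- degree below `deg π`, hence coprime to `π`, which also annihilates `y`.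
  obtain ⟨lam, hlam⟩ : ∃ lam : Module.Dual F K, lam ρ.leadingCoeff ≠ 0 := by
    by_contra! h
    exact hlead ((Module.forall_dual_apply_eq_zero_iff F _).mp h)
  set r : F[X] := ∑ j ∈ Finset.range (ρ.natDegree + 1), C (lam (ρ.coeff j)) * X ^ j with hr
  have hry : aeval A r *ᵥ y = 0 := by
    ext i
    have h1 := congrArg lam (congrFun hρy i)
    rw [aeval_eq_sum_range, Matrix.sum_mulVec, Finset.sum_apply, map_sum] at h1
    rw [hr, map_sum, Matrix.sum_mulVec, Finset.sum_apply]
    simp only [Pi.zero_apply, map_zero] at h1 ⊢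
    rw [← h1]
    refine Finset.sum_congr rfl fun j _ => ?_
    have h5 : A' ^ j = (A ^ j).map (algebraMap F K) := by
      have := hmap (X ^ j)
      simpa using this
    rw [h5, Matrix.smul_mulVec, Pi.smul_apply, ← RingHom.map_mulVec, smul_eq_mul,
      mul_comm (ρ.coeff j), ← Algebra.smul_def, map_smul, ← smul_eq_C_mul, map_smul, map_pow, aeval_X,
      Matrix.smul_mulVec, Pi.smul_apply, smul_eq_mul, smul_eq_mul, mul_comm]
  have hr0 : r ≠ 0 := by
    intro h0
    have h1 := congrArg (coeff · ρ.natDegree) h0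
    simp only [hr, finsetSum_coeff, coeff_C_mul_X_pow, coeff_zero] at h1
    rw [Finset.sum_ite_eq, if_pos (by simp)] at h1
    exact hlam h1
  have hrdeg : r.natDegree < π.natDegree := by
    refine lt_of_le_of_lt (natDegree_sum_le_of_forall_le _ _ fun j hj => ?_) hρ0
    refine (natDegree_C_mul_X_pow_le _ _).trans ?_
    have := Finset.mem_range.mp hj
    omega
  have hcop : IsCoprime π r := by
    rw [hπ.coprime_iff_not_dvd]
    intro hd
    exact absurd (natDegree_le_of_dvd hd hr0) (by omega)
  obtain ⟨a, b, hab⟩ := hcop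
  have hπy : aeval A π *ᵥ y = 0 := by
    rw [hy, Matrix.mulVec_mulVec, ← map_mul, ← hc, Matrix.aeval_self_charpoly, Matrix.zero_mulVec]
  have h1 : aeval A (a * π + b * r) *ᵥ y = 0 := by
    rw [map_add, map_mul, map_mul, Matrix.add_mulVec, ← Matrix.mulVec_mulVec, hπy,
      ← Matrix.mulVec_mulVec, hry]
    simp
  rwa [hab, map_one, Matrix.one_mulVec] at h1

/-- If `g` divides both `χ(A; x)` and `uᵀ adj(xI - A) u`, where `A` is symmetric, then the quotient
of `χ(A; x)` by the square-free part of `g` annihilates `u`. -/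
theorem aeval_div_radical_mulVec {F : Type*} [Field F] [DecidableEq F] {A : Matrix ι ι F}
    (hA : A.IsSymm) (u : ι → F) {g : F[X]} (hg : g ∣ A.charpoly)
    (hφ : g ∣ (C ∘ u) ⬝ᵥ (A.charmatrix.adjugate *ᵥ (C ∘ u))) :
    aeval A (A.charpoly / UniqueFactorizationMonoid.radical g) *ᵥ u = 0 := by
  -- The annihilator of `u`; its generator `m` is the minimal polynomial of `u`, and `χ = m c`. The
  -- claim amounts to `radical g ∣ c`.
  let I : Ideal F[X] :=
    { carrier := {f | aeval A f *ᵥ u = 0}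
      add_mem' := fun {f g} hf hg => by
        simp only [Set.mem_ofPred_eq] at *
        rw [map_add, Matrix.add_mulVec, hf, hg, add_zero]
      zero_mem' := by simp
      smul_mem' := fun f g hg => by
        simp only [Set.mem_ofPred_eq] at *
        rw [smul_eq_mul, map_mul, ← Matrix.mulVec_mulVec, hg, Matrix.mulVec_zero] }
  have hI : ∀ f, aeval A f *ᵥ u = 0 ↔ Submodule.IsPrincipal.generator I ∣ f := fun f =>
    Submodule.IsPrincipal.mem_iff_generator_dvd I
  have hχ0 : A.charpoly ≠ 0 := A.charpoly_monic.ne_zero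
  have hg0 : g ≠ 0 := ne_zero_of_dvd_ne_zero hχ0 hg
  obtain ⟨c, hc⟩ := (hI A.charpoly).mp (by rw [Matrix.aeval_self_charpoly, Matrix.zero_mulVec])
  generalize Submodule.IsPrincipal.generator I = m at hI hc
  have hm0 : m ≠ 0 := by rintro rfl; simp [hχ0] at hc
  have hc0 : c ≠ 0 := by rintro rfl; simp [hχ0] at hc
  have hrad : UniqueFactorizationMonoid.radical g ∣ c := by
    rw [UniqueFactorizationMonoid.radical_dvd_iff_primeFactors_subset hc0]
    intro π hπ
    rw [UniqueFactorizationMonoid.mem_primeFactors,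
      UniqueFactorizationMonoid.mem_normalizedFactors_iff' hg0] at hπ
    rw [UniqueFactorizationMonoid.mem_primeFactors,
      UniqueFactorizationMonoid.mem_normalizedFactors_iff' hc0]
    refine ⟨hπ.1, hπ.2.1, ?_⟩
    -- For a prime factor `π` of `g`, the cofactor `χ / π` annihilates `u`, so `m ∣ χ / π`, which
    -- means `π ∣ c`.
    obtain ⟨c', hc'⟩ := hπ.2.2.trans hg
    obtain ⟨d, hd⟩ := (hI c').mp
      (aeval_mulVec_eq_zero_of_irreducible hA u hπ.1 hc' (hπ.2.2.trans hφ))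
    refine ⟨d, mul_left_cancel₀ hm0 ?_⟩
    rw [← hc, hc', hd]; ring
  obtain ⟨d, rfl⟩ := hrad
  rw [hI, hc, show m * (UniqueFactorizationMonoid.radical g * d) =
    UniqueFactorizationMonoid.radical g * (m * d) by ring,
    mul_div_cancel_left₀ _ UniqueFactorizationMonoid.radical_ne_zero]
  exact dvd_mul_right _ _

theorem charpoly_add_vecMulVec {R : Type*} [CommRing R] [IsDomain R] (A : Matrix ι ι R)
    (u v : ι → R) : (A + Matrix.vecMulVec u v).charpoly =
      A.charpoly - (C ∘ v) ⬝ᵥ (A.charmatrix.adjugate *ᵥ (C ∘ u)) := by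
  have h1 := det_add_vecMulVec (M := A.charmatrix) A.charpoly_monic.ne_zero (-(C ∘ u)) (C ∘ v)
  rw [Matrix.mulVec_neg, dotProduct_neg, ← sub_eq_add_neg] at h1
  rw [Matrix.charpoly, Matrix.charpoly, ← h1]
  congr 1
  refine Matrix.ext fun i j => ?_
  simp only [Matrix.charmatrix, Matrix.sub_apply, Matrix.add_apply, RingHom.mapMatrix_apply,
    Matrix.map_apply, Matrix.vecMulVec_apply, map_add, Pi.neg_apply, Function.comp_apply, map_mul]
  ring

omit [Fintype ι] [DecidableEq ι] in
theorem of_one_eq_vecMulVec {R : Type*} [CommRing R] :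
    (Matrix.of fun _ _ => 1 : Matrix ι ι R) = Matrix.vecMulVec 1 1 := by
  ext i j
  simp [Matrix.vecMulVec_apply]

/-- `J` is the rank-one matrix `e eᵀ`, so the gcd divides `χ(A) - χ(A + J) = eᵀ adj(xI - A) e`. -/
theorem div_radical_gcd_spec {F : Type*} [Field F] [DecidableEq F] {A : Matrix ι ι F}
    (hA : A.IsSymm) :
    aeval A (A.charpoly / UniqueFactorizationMonoid.radical (EuclideanDomain.gcd A.charpoly
      (A + Matrix.of fun _ _ => 1).charpoly)) *ᵥ 1 = 0 ∧
    A.charpoly / UniqueFactorizationMonoid.radical (EuclideanDomain.gcd A.charpoly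
      (A + Matrix.of fun _ _ => 1).charpoly) ≠ 0 := by
  have hl := EuclideanDomain.gcd_dvd_left A.charpoly (A + Matrix.of fun _ _ => 1).charpoly
  have hr := EuclideanDomain.gcd_dvd_right A.charpoly (A + Matrix.of fun _ _ => 1).charpoly
  generalize EuclideanDomain.gcd A.charpoly (A + Matrix.of fun _ _ => 1).charpoly = g at hl hr
  refine ⟨aeval_div_radical_mulVec hA 1 hl ?_, fun h0 => ?_⟩
  · have h3 := dvd_sub hl hr
    rwa [of_one_eq_vecMulVec, charpoly_add_vecMulVec, sub_sub_cancel] at h3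
  · have h1 := EuclideanDomain.mul_div_cancel' UniqueFactorizationMonoid.radical_ne_zero
      (UniqueFactorizationMonoid.radical_dvd_self.trans hl)
    rw [h0, mul_zero] at h1
    exact A.charpoly_monic.ne_zero h1.symm

end Annihilators

/-! ### Symmetric matrices with zero diagonal over `F_2`. -/

section ModTwo

variable {ι : Type*} [Fintype ι] [DecidableEq ι]

omit [DecidableEq ι] in
theorem dotProduct_mulVec_self_of_alternating {A : Matrix ι ι (ZMod 2)} (hA : A.IsSymm)
    (hd : ∀ i, A i i = 0) (x : ι → ZMod 2) : x ⬝ᵥ (A *ᵥ x) = 0 := by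
  simp only [dotProduct, Matrix.mulVec, Finset.mul_sum]
  rw [← Finset.sum_product']
  refine Finset.sum_involution (fun a _ => (a.2, a.1)) ?_ ?_ (by simp) (by simp)
  · rintro ⟨i, j⟩ -
    simp only
    rw [hA.apply i j, show x j * (A i j * x i) = x i * (A i j * x j) by ring, CharTwo.add_self_eq_zero]
  · rintro ⟨i, j⟩ - h h'
    simp only [Prod.mk.injEq] at h'
    apply h
    simp [h'.1, hd]

/-- For even exponents, `tr(M²) = (tr M)²` over `F_2` permits induction. For odd ones, each diagonal
entry of `A^(2j+1)` is the alternating form `xᵀ A x` at a column of `A^j`. -/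
theorem trace_pow_eq_zero_of_alternating {A : Matrix ι ι (ZMod 2)} (hA : A.IsSymm)
    (hd : ∀ i, A i i = 0) : ∀ k, k ≠ 0 → (A ^ k).trace = 0 := by
  intro k
  induction k using Nat.strong_induction_on with
  | _ k ih =>
    intro hk
    rcases Nat.even_or_odd' k with ⟨j, rfl | rfl⟩
    · rw [mul_comm, pow_mul, ZMod.trace_pow_card, ih j (by omega) (by omega)]
      simp
    · refine Finset.sum_eq_zero fun i _ => ?_
      have h := dotProduct_mulVec_self_of_alternating hA hd ((A ^ j) *ᵥ Pi.single i 1)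
      have hpow : A ^ (2 * j + 1) = (A ^ j)ᵀ * (A * A ^ j) := by
        rw [(hA.pow j).eq, ← pow_succ', ← pow_add]
        congr 1; ring
      rw [Matrix.mulVec_mulVec, ← Matrix.vecMul_transpose, ← Matrix.dotProduct_mulVec,
        Matrix.mulVec_mulVec, ← hpow] at h
      simpa using h

/-- Newton's identities: in `χ' = tr adj(xI - A)` only the trace of `A^0` survives, so `j c_j = n
c_j`. For `j = 0` this relation comes from the trace of the Cayley–Hamilton identity. -/
theorem charpoly_coeff_eq_zero_of_alternating {A : Matrix ι ι (ZMod 2)} (hA : A.IsSymm)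
    (hd : ∀ i, A i i = 0) (j : ℕ) (hj : ¬ Even (j + Fintype.card ι)) : A.charpoly.coeff j = 0 := by
  have htr := trace_pow_eq_zero_of_alternating hA hd
  have hpar : (j : ZMod 2) + Fintype.card ι = 1 := by
    rw [Nat.not_even_iff_odd, ← ZMod.natCast_eq_one_iff_odd] at hj
    exact_mod_cast hj
  suffices h : (j : ZMod 2) * A.charpoly.coeff j = Fintype.card ι * A.charpoly.coeff j by
    rw [← one_mul (A.charpoly.coeff j), ← hpar, add_mul, h, CharTwo.add_self_eq_zero]
  rcases j with - | k
  · have h := congrArg Matrix.trace A.aeval_self_charpoly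
    rw [aeval_eq_sum_range, Matrix.trace_sum, Finset.sum_eq_single 0] at h
    · simpa [mul_comm] using h.symm
    · intro b _ hb
      rw [Matrix.trace_smul, htr b hb, smul_zero]
    · simp
  · obtain ⟨B, hB⟩ := coeff_adjugate_charmatrix A
    have h := congrArg (coeff · k) (derivative_charpoly A)
    simp only [coeff_derivative] at h
    have h2 := congrArg Matrix.trace (hB (B + 1) (by omega) k)
    rw [Matrix.trace_sum, Finset.sum_eq_single 0] at h2
    · simp only [Matrix.trace, Matrix.diag_apply, Matrix.map_apply, finsetSum_coeff] at h h2
      rw [h2] at h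
      push_cast
      rw [mul_comm, h]
      simp
    · intro b _ hb
      rw [Matrix.trace_smul, htr b hb, smul_zero]
    · simp

omit [DecidableEq ι] in
-- A diagonal entry of `B²` is a sum of squares along a row, and squaring is the identity on `F_2`,
-- so it equals the row sum.
theorem mulVec_one_eq_zero_of_sq {B : Matrix ι ι (ZMod 2)} (hB : B.IsSymm) (h : B * B = 0) :
    B *ᵥ 1 = 0 := by
  ext i
  have h1 := congrFun (congrFun h i) i
  rw [Matrix.mul_apply] at h1
  rw [Matrix.mulVec, dotProduct, Pi.zero_apply, ← Matrix.zero_apply (α := ZMod 2) i i, ← h1]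
  refine Finset.sum_congr rfl fun j _ => ?_
  rw [hB.apply i j]
  rw [Pi.one_apply, mul_one, ← sq, ZMod.pow_card]

end ModTwo

/-! ### The congruence `M_p(A) e ≡ 0 (mod p)`. -/

section Graph

variable {n : ℕ} (G : SimpleGraph (Fin n))

theorem adj_map {R S : Type*} [CommRing R] [CommRing S] (f : R →+* S) :
    (adj R G).map f = adj S G := by
  classical
  ext i j
  simp [adj, SimpleGraph.adjMatrix_apply, apply_ite f]

theorem isSymm_adj (R : Type*) [CommRing R] : (adj R G).IsSymm := by
  classical
  exact SimpleGraph.isSymm_adjMatrix G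

theorem adj_self (R : Type*) [CommRing R] (i : Fin n) : adj R G i i = 0 := by
  classical
  simp [adj]

theorem charpoly_adj {R : Type*} [CommRing R] :
    (adj R G).charpoly = (adj ℤ G).charpoly.map (Int.castRingHom R) := by
  rw [← Matrix.charpoly_map, ← adj_map G (Int.castRingHom R)]

theorem isSymm_aeval {R : Type*} [CommRing R] {A : Matrix (Fin n) (Fin n) R} (hA : A.IsSymm)
    (f : R[X]) : (aeval A f).IsSymm := by
  rw [aeval_eq_sum_range, Matrix.IsSymm, Matrix.transpose_sum]
  exact Finset.sum_congr rfl fun i _ => by rw [Matrix.transpose_smul, (hA.pow i).eq]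

/-- Modulo 2 only exponents of the parity of `n` survive in `χ`, so `χ = x^(n % 2) P(x²) = x^(n % 2)
P(x)²` by Frobenius, while `ψ = x^(n % 2) P`. -/
theorem psi_map_sq : ((psi G).map (Int.castRingHom (ZMod 2))) ^ 2 =
    X ^ (n % 2) * (adj (ZMod 2) G).charpoly := by
  set χ := (adj (ZMod 2) G).charpoly with hχ
  have hdeg : χ.natDegree = n := by rw [hχ, Matrix.charpoly_natDegree_eq_dim, Fintype.card_fin]
  set P : (ZMod 2)[X] := ∑ i ∈ Finset.range (n / 2 + 1), C (χ.coeff (n - 2 * i)) * X ^ (n / 2 - i)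
    with hP
  have hcoeff : ∀ l, P.coeff l = χ.coeff (2 * l + n % 2) := by
    intro l
    simp only [hP, finsetSum_coeff, coeff_C_mul_X_pow]
    by_cases hl : l ≤ n / 2
    · rw [Finset.sum_eq_single (n / 2 - l), if_pos (by omega)]
      · congr 1; omega
      · intro b hb hne
        have := Finset.mem_range.mp hb
        exact if_neg (by omega)
      · intro h; exact absurd (Finset.mem_range.mpr (by omega)) h
    · rw [coeff_eq_zero_of_natDegree_lt (by omega)]
      exact Finset.sum_eq_zero fun b _ => if_neg (by omega)
  have hsq : X ^ (n % 2) * P ^ 2 = χ := by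
    rw [← ZMod.expand_card]
    ext j
    rw [coeff_X_pow_mul', coeff_expand two_pos]
    by_cases hj : Even (j + n)
    · rw [Nat.even_iff] at hj
      rw [if_pos (by omega), if_pos (by omega), hcoeff]
      congr 1
      omega
    · rw [hχ, charpoly_coeff_eq_zero_of_alternating (isSymm_adj G _) (adj_self G _) j (by simpa using hj)]
      rw [Nat.even_iff] at hj
      split_ifs
      · omega
      · rfl
      · rfl
  have hψ : (psi G).map (Int.castRingHom (ZMod 2)) = X ^ (n % 2) * P := by
    rw [psi, Polynomial.map_mul]
    congr 1
    · by_cases hn : Even n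
      · simp [hn, Nat.even_iff.mp hn]
      · simp [hn, Nat.odd_iff.mp (Nat.not_even_iff_odd.mp hn)]
    · rw [hP, Polynomial.map_sum]
      refine Finset.sum_congr rfl fun i _ => ?_
      rw [hχ, charpoly_adj (R := ZMod 2), coeff_map]
      simp only [Polynomial.map_mul, map_C, Polynomial.map_pow, map_X]
  rw [hψ, ← hsq]
  ring

/-- This is what makes the division by `p` in `W^(p)` exact. For `p = 2`, `M_2(A)² = 0` by
Cayley–Hamilton. -/
theorem Mbar_spec (p : Nat.Primes) :
    aeval (adj (ZMod p) G) (Mbar G p) *ᵥ 1 = 0 ∧ Mbar G p ≠ 0 := by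
  by_cases h2 : (p : ℕ) = 2
  · obtain ⟨p, hp⟩ := p
    obtain rfl : p = 2 := h2
    have h := psi_map_sq G
    have hM : Mbar G ⟨2, hp⟩ = (psi G).map (Int.castRingHom (ZMod 2)) := if_pos rfl
    constructor
    · refine mulVec_one_eq_zero_of_sq (isSymm_aeval (isSymm_adj G _) _) ?_
      rw [hM]
      refine ((map_mul (aeval (adj (ZMod 2) G)) _ _).symm.trans ?_)
      rw [← sq, h, map_mul, Matrix.aeval_self_charpoly, mul_zero]
    · rw [hM]
      intro h0
      rw [h0] at h
      have h3 := (adj (ZMod 2) G).charpoly_monic.ne_zero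
      simp [h3] at h
  · rw [show Mbar G p = mainPoly G p from if_neg h2]
    exact div_radical_gcd_spec (isSymm_adj G (ZMod p))

end Graph

/-! ### Primes whose square divides the discriminant. -/

section Discriminant

variable {ι : Type*} [Fintype ι] [DecidableEq ι]

theorem det_aeval_eq_prod {K : Type*} [Field K] [IsAlgClosed K] [Nonempty ι] (A : Matrix ι ι K)
    (g : K[X]) : (aeval A g).det = (A.charpoly.roots.map g.eval).prod := by
  have hsplit := IsAlgClosed.splits A.charpoly
  have hcard : A.charpoly.roots.card = Fintype.card ι := by
    rw [← hsplit.natDegree_eq_card_roots, Matrix.charpoly_natDegree_eq_dim]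
  have hlin : ∀ a, (aeval A (X - C a)).det = (A.charpoly.roots.map (· - a)).prod := by
    intro a
    have h1 := Matrix.eval_charpoly A a
    rw [hsplit.eq_prod_roots, A.charpoly_monic.leadingCoeff, C_1, one_mul, eval_multiset_prod,
      Multiset.map_map] at h1
    have h2 : aeval A (X - C a) = -(Matrix.scalar ι a - A) := by
      simp [neg_sub, Matrix.scalar_apply, Matrix.algebraMap_eq_diagonal]
    have h3 : A.charpoly.roots.map (· - a) =
        (A.charpoly.roots.map (eval a ∘ fun x => X - C x)).map Neg.neg := by
      rw [Multiset.map_map]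
      simp
    rw [h2, Matrix.det_neg, ← h1, ← hcard, h3, Multiset.prod_map_neg, Multiset.card_map]
  let φ : K[X] →* K := Matrix.detMonoidHom.comp (aeval A : K[X] →ₐ[K] _).toRingHom.toMonoidHom
  have hφ : ∀ f, φ f = (aeval A f).det := fun _ => rfl
  have hg := (IsAlgClosed.splits g).eq_prod_roots
  generalize g.leadingCoeff = c at hg
  generalize g.roots = s at hg
  subst hg
  rw [← hφ, map_mul, map_multiset_prod, Multiset.map_map]
  simp only [Function.comp_apply, hφ, hlin, eval_mul, eval_C, eval_multiset_prod, Multiset.map_map,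
    eval_sub, eval_X]
  rw [Multiset.prod_map_mul, Multiset.map_const', Multiset.prod_replicate, hcard,
    Multiset.prod_map_prod_map]
  congr 1
  simp [aeval_C, Matrix.algebraMap_eq_diagonal]

/-- Up to sign, the discriminant of `χ(A; x)` is the determinant of `χ'(A)`. -/
theorem det_aeval_derivative_charpoly [Nonempty ι] (A : Matrix ι ι ℤ) :
    (aeval A (derivative A.charpoly)).det =
      (-1) ^ (Fintype.card ι * (Fintype.card ι - 1) / 2) * A.charpoly.discr := by
  have hdeg := A.charpoly_natDegree_eq_dim
  have hpos : 0 < A.charpoly.degree := by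
    rw [← natDegree_pos_iff_degree_pos, hdeg]; exact Fintype.card_pos
  have h := resultant_deriv hpos
  rw [A.charpoly_monic.leadingCoeff, mul_one, hdeg] at h
  rw [← h]
  apply (Int.castRingHom ℂ).injective_int
  rw [← resultant_map_map, ← derivative_map, ← Matrix.charpoly_map, RingHom.map_det,
    RingHom.mapMatrix_apply, map_aeval_matrix, ← derivative_map, ← Matrix.charpoly_map,
    det_aeval_eq_prod]
  have h2 := resultant_eq_prod_eval (A.map (Int.castRingHom ℂ)).charpoly
    (derivative (A.map (Int.castRingHom ℂ)).charpoly) (Fintype.card ι - 1)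
    ((natDegree_derivative_le _).trans (by rw [Matrix.charpoly_natDegree_eq_dim]))
    (IsAlgClosed.splits _)
  rw [Matrix.charpoly_natDegree_eq_dim, (Matrix.charpoly_monic _).leadingCoeff, one_pow,
    one_mul] at h2
  exact h2.symm

/-- Replacing column `i` by `S u` multiplies the determinant by `u i`, prime to `p`, and exposes one
factor `p`. The same combination of rows exposes a second: its entries off `i` come from `S u` by
symmetry, and the one at `i` is `uᵀ S u / p`. -/
theorem sq_dvd_det {S : Matrix ι ι ℤ} (hS : S.IsSymm) {p : ℤ} (hp : Prime p) {u : ι → ℤ} {i : ι}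
    (hu : ¬ p ∣ u i) (h1 : ∀ j, p ∣ (S *ᵥ u) j) (h2 : p ^ 2 ∣ u ⬝ᵥ (S *ᵥ u)) :
    p ^ 2 ∣ S.det := by
  choose c hc using h1
  have hSu : S *ᵥ u = p • c := funext hc
  have hcol : u i * S.det = p * (S.updateCol i c).det := by
    rw [← smul_eq_mul, ← Matrix.det_updateCol_sum, ← Matrix.det_updateCol_smul, ← hSu]
    congr 2
    ext j
    simp [Matrix.mulVec, dotProduct, mul_comm]
  set T := S.updateCol i c with hT
  have huc : p ∣ u ⬝ᵥ c := by
    rw [hSu, dotProduct_smul, smul_eq_mul, sq] at h2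
    exact Int.dvd_of_mul_dvd_mul_left hp.ne_zero h2
  have hrow : p ∣ u i * T.det := by
    have h3 : ∀ j, p ∣ (∑ k, u k • T k) j := by
      intro j
      rw [Finset.sum_apply]
      simp only [Pi.smul_apply, smul_eq_mul, hT, Matrix.updateCol_apply]
      by_cases hj : j = i
      · simpa [hj, dotProduct] using huc
      · simp only [hj, if_false]
        refine ⟨c j, ?_⟩
        rw [← hc j, Matrix.mulVec, dotProduct]
        exact Finset.sum_congr rfl fun k _ => by rw [hS.apply k j, mul_comm]
    choose d hd using h3
    rw [← smul_eq_mul, ← Matrix.det_updateRow_sum, show (∑ k, u k • T k) = p • d from funext hd,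
      Matrix.det_updateRow_smul]
    exact dvd_mul_right _ _
  have hco : IsCoprime (p ^ 2) (u i) :=
    ((Prime.coprime_iff_not_dvd hp).mpr hu).pow_left
  refine hco.dvd_of_dvd_mul_left ?_
  rw [hcol, sq]
  exact mul_dvd_mul_left p ((hp.dvd_or_dvd hrow).resolve_left hu)

theorem aeval_mulVec_of_mulVec_eq {K : Type*} [Field K] {A : Matrix ι ι K} {v : ι → K} {μ : K}
    (h : A *ᵥ v = μ • v) (f : K[X]) : aeval A f *ᵥ v = f.eval μ • v := by
  obtain ⟨q, hq⟩ := X_sub_C_dvd_sub_C_eval (a := μ) (p := f)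
  have h1 : f = q * (X - C μ) + C (f.eval μ) := by rw [mul_comm, ← hq]; ring
  nth_rewrite 1 [h1]
  rw [map_add, map_mul, map_sub, aeval_X, aeval_C, aeval_C, Matrix.add_mulVec,
    ← Matrix.mulVec_mulVec, Matrix.sub_mulVec, h, Algebra.algebraMap_eq_smul_one,
    Algebra.algebraMap_eq_smul_one, Matrix.smul_mulVec, Matrix.smul_mulVec, Matrix.one_mulVec,
    sub_self, Matrix.mulVec_zero, zero_add]

omit [Fintype ι] [DecidableEq ι] in
theorem dual_mulVec {F K : Type*} [Field F] [Field K] [Algebra F K] (lam : K →ₗ[F] F)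
    {κ : Type*} [Fintype κ] (M : Matrix ι κ F) (v : κ → K) :
    lam ∘ (M.map (algebraMap F K) *ᵥ v) = M *ᵥ (lam ∘ v) := by
  ext i
  simp [Matrix.mulVec, dotProduct, ← Algebra.smul_def]

/-- If the column space of `R` is a nonzero totally isotropic invariant subspace for the symmetric
matrix `A`, then `χ'(A)` is singular on it. -/
theorem exists_aeval_derivative_mulVec_eq_zero {F : Type*} [Field F] {A B R : Matrix ι ι F}
    (hA : A.IsSymm) (hAB : A * R = R * B) (hR : Rᵀ * R = 0) (hR0 : R ≠ 0) :
    ∃ z, R *ᵥ z ≠ 0 ∧ aeval A (derivative A.charpoly) *ᵥ (R *ᵥ z) = 0 := by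
  let K := AlgebraicClosure F
  have hinj := (algebraMap F K).injective
  set A' := A.map (algebraMap F K) with hA'
  set R' := R.map (algebraMap F K) with hR'
  have hAB' : A' * R' = R' * B.map (algebraMap F K) := by
    rw [hA', hR', ← Matrix.map_mul, hAB, Matrix.map_mul]
  have hRR' : R'ᵀ * R' = 0 := by
    rw [hR', ← Matrix.transpose_map, ← Matrix.map_mul, hR, Matrix.map_zero _ (map_zero _)]
  let V := LinearMap.range R'.mulVecLin
  have hV : ∀ x ∈ V, A'.mulVecLin x ∈ V := by
    rintro _ ⟨z, rfl⟩
    refine ⟨B.map (algebraMap F K) *ᵥ z, ?_⟩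
    rw [Matrix.mulVecLin_apply, Matrix.mulVecLin_apply, Matrix.mulVecLin_apply,
      Matrix.mulVec_mulVec, Matrix.mulVec_mulVec, hAB']
  have : Nontrivial V := by
    rw [Submodule.nontrivial_iff_ne_bot]
    intro hbot
    apply hR0
    have h1 : R'.mulVecLin = 0 := LinearMap.range_eq_bot.mp hbot
    ext i j
    have h2 := congrFun (LinearMap.congr_fun h1 (Pi.single j 1)) i
    apply hinj
    simpa [hR'] using h2
  obtain ⟨μ, hμ⟩ := Module.End.exists_eigenvalue (A'.mulVecLin.restrict hV)
  obtain ⟨⟨v, z, hz⟩, hv⟩ := hμ.exists_hasEigenvector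
  have hv0 : v ≠ 0 := fun h => hv.2 (Subtype.ext h)
  have hAv : A' *ᵥ v = μ • v := congrArg Subtype.val hv.apply_eq_smul
  have hvz : v = R' *ᵥ z := hz.symm
  have hvv : v ⬝ᵥ v = 0 := by
    rw [hvz, Matrix.dotProduct_mulVec, ← Matrix.mulVec_transpose, Matrix.mulVec_mulVec, hRR']
    simp
  have hsymm : (Matrix.scalar ι μ - A').IsSymm :=
    (by simp [Matrix.IsSymm] : (Matrix.scalar ι μ).IsSymm).sub (hA.map _)
  have hMv : (Matrix.scalar ι μ - A') *ᵥ v = 0 := by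
    rw [Matrix.sub_mulVec, hAv, Matrix.scalar_apply]
    simp
  -- `χ'(μ)` is the trace of `adj(μI - A)`, which vanishes because the eigenvector is isotropic.
  have hder : (derivative A'.charpoly).eval μ = 0 := by
    rw [derivative_charpoly, ← trace_adjugate_eq_zero hsymm hv0 hMv hvv, ← eval_adjugate_charmatrix]
    simp [Matrix.trace, eval_finsetSum]
  have hker : aeval A' (derivative A'.charpoly) *ᵥ v = 0 := by
    rw [aeval_mulVec_of_mulVec_eq hAv, hder, zero_smul]
  have hmap : aeval A' (derivative A'.charpoly) =
      (aeval A (derivative A.charpoly)).map (algebraMap F K) := by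
    rw [map_aeval_matrix, ← derivative_map, ← Matrix.charpoly_map]
  obtain ⟨k, hk⟩ := Function.ne_iff.mp hv0
  -- A functional nonzero on one coordinate of `v` moves the kernel vector back to `F`, and keeps it
  -- in the column space since `R` is defined over `F`.
  obtain ⟨lam, hlam⟩ : ∃ lam : Module.Dual F K, lam (v k) ≠ 0 := by
    by_contra! h
    exact hk ((Module.forall_dual_apply_eq_zero_iff F _).mp h)
  have hlv : R *ᵥ (lam ∘ z) = lam ∘ v := by rw [hvz, hR', dual_mulVec]
  refine ⟨lam ∘ z, fun h => hlam ?_, ?_⟩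
  · rw [hlv] at h
    exact congrFun h k
  · rw [hlv, ← dual_mulVec, ← hmap, hker]
    ext; simp

theorem aeval_mul_comm {R : Type*} [CommRing R] {A B X : Matrix ι ι R} (h : A * X = X * B)
    (f : R[X]) : aeval A f * X = X * aeval B f := by
  induction f using Polynomial.induction_on' with
  | add p q hp hq => rw [map_add, map_add, add_mul, mul_add, hp, hq]
  | monomial k a =>
    have hk : A ^ k * X = X * B ^ k := by
      induction k with
      | zero => simp
      | succ k ih => rw [pow_succ, mul_assoc, h, ← mul_assoc, ih, mul_assoc, ← pow_succ]
    rw [aeval_monomial, aeval_monomial, mul_assoc, hk, ← mul_assoc, ← mul_assoc,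
      Algebra.commutes]

theorem sq_dvd_discr_charpoly {n : ℕ} {A B X : Matrix (Fin n) (Fin n) ℤ} (hA : A.IsSymm)
    (hAB : A * X = X * B) {l : ℤ} (hX : Xᵀ * X = l ^ 2 • 1) {p : ℕ} (hp : p.Prime)
    (hpl : (p : ℤ) ∣ l) (hX0 : ¬ ∀ i j, (p : ℤ) ∣ X i j) : (p : ℤ) ^ 2 ∣ A.charpoly.discr := by
  have : Fact p.Prime := ⟨hp⟩
  have : Nonempty (Fin n) := by
    by_contra h
    rw [not_nonempty_iff] at h
    exact hX0 fun i => h.elim i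
  set c := Int.castRingHom (ZMod p) with hc
  have hc0 : ∀ a : ℤ, c a = 0 ↔ (p : ℤ) ∣ a := fun a => ZMod.intCast_zmod_eq_zero_iff_dvd a p
  have hl0 : c l = 0 := (hc0 l).mpr hpl
  obtain ⟨z, hz0, hz⟩ := exists_aeval_derivative_mulVec_eq_zero (A := A.map c) (B := B.map c)
    (R := X.map c) (hA.map _) (by rw [← Matrix.map_mul, hAB, Matrix.map_mul])
    (by
      rw [← Matrix.transpose_map, ← Matrix.map_mul, hX]
      ext i j
      rw [Matrix.map_apply, Matrix.smul_apply, smul_eq_mul, map_mul, map_pow, hl0]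
      simp)
    (fun h => hX0 fun i j => (hc0 _).mp (congrFun (congrFun h i) j))
  rw [Matrix.charpoly_map, derivative_map, ← map_aeval_matrix] at hz
  set S := aeval A (derivative A.charpoly) with hS
  obtain ⟨w, rfl⟩ : ∃ w : Fin n → ℤ, c ∘ w = z :=
    ⟨fun i => ((z i).val : ℤ), funext fun i => by simp [hc]⟩
  have hcX : X.map c *ᵥ (c ∘ w) = c ∘ (X *ᵥ w) := (_root_.funext (RingHom.map_mulVec _ _ _)).symm
  have hcS : S.map c *ᵥ (c ∘ (X *ᵥ w)) = c ∘ (S *ᵥ (X *ᵥ w)) :=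
    (_root_.funext (RingHom.map_mulVec _ _ _)).symm
  rw [hcX] at hz0 hz
  rw [hcS] at hz
  obtain ⟨i, hi⟩ := Function.ne_iff.mp hz0
  have hdet : (p : ℤ) ^ 2 ∣ S.det := by
    refine sq_dvd_det (isSymm_aeval hA _) (Nat.prime_iff_prime_int.mp hp) (u := X *ᵥ w) (i := i)
      (fun h => hi ((hc0 _).mpr h)) (fun j => (hc0 _).mp (congrFun hz j)) ?_
    -- With `u = X w`, the form `uᵀ χ'(A) u` becomes `wᵀ Xᵀ X χ'(B) w`, where `χ'` is still that of
    -- `A`; the factor `Xᵀ X = l²` supplies `p²`.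
    rw [Matrix.mulVec_mulVec, aeval_mul_comm hAB, ← Matrix.vecMul_transpose,
      ← Matrix.dotProduct_mulVec, Matrix.mulVec_mulVec, ← Matrix.mul_assoc, hX, smul_mul_assoc,
      Matrix.smul_mulVec, dotProduct_smul, smul_eq_mul]
    exact Dvd.dvd.mul_right (pow_dvd_pow_of_dvd hpl 2) _
  rw [hS, det_aeval_derivative_charpoly] at hdet
  exact (IsUnit.dvd_mul_left (isUnit_one.neg.pow _)).mp hdet

end Discriminant

/-! ### What the generalized spectrum determines, and the orthogonal matrix `Q`. -/

section GeneralizedSpectrum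

variable {n : ℕ}

/-- `eᵀ adj(xI - A) e`. -/
noncomputable def walkPoly (A : Matrix (Fin n) (Fin n) ℤ) : ℤ[X] :=
  (C ∘ (1 : Fin n → ℤ)) ⬝ᵥ (A.charmatrix.adjugate *ᵥ (C ∘ (1 : Fin n → ℤ)))

theorem charpoly_add_of_one (A : Matrix (Fin n) (Fin n) ℤ) :
    (A + Matrix.of fun _ _ => 1).charpoly = A.charpoly - walkPoly A := by
  rw [of_one_eq_vecMulVec, charpoly_add_vecMulVec, walkPoly]

theorem adj_compl (R : Type*) [CommRing R] (G : SimpleGraph (Fin n)) :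
    adj R Gᶜ = Matrix.of (fun _ _ => 1) - 1 - adj R G := by
  classical
  ext i j
  by_cases hij : i = j
  · subst hij; simp [adj]
  · by_cases h : G.Adj i j <;> simp [adj, SimpleGraph.adjMatrix_apply, hij, h]

/-- Subtracting `J` from `A` gives `-(I + adj Gᶜ)`, so the rank-one update formula expresses `eᵀ
adj(xI - A) e` through the two characteristic polynomials. -/
theorem eval_walkPoly (G : SimpleGraph (Fin n)) (s : ℤ) :
    (walkPoly (adj ℤ G)).eval s =
      (-1) ^ n * (adj ℤ Gᶜ).charpoly.eval (-s - 1) - (adj ℤ G).charpoly.eval s := by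
  have h := congrArg (eval s) (charpoly_add_vecMulVec (adj ℤ G) (-1) 1)
  have h1 : Matrix.scalar (Fin n) s - (adj ℤ G + Matrix.vecMulVec (-1) 1) =
      -(Matrix.scalar (Fin n) (-s - 1) - adj ℤ Gᶜ) := by
    rw [adj_compl]
    ext i j
    by_cases hij : i = j
    · subst hij
      simp
      ring
    · simp [hij]
      ring
  have h2 : C ∘ (-1 : Fin n → ℤ) = -(C ∘ (1 : Fin n → ℤ)) := by
    ext i; simp
  rw [Matrix.eval_charpoly, h1, Matrix.det_neg, ← Matrix.eval_charpoly, Fintype.card_fin, h2,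
    Matrix.mulVec_neg, dotProduct_neg, sub_neg_eq_add, eval_add] at h
  rw [h, walkPoly]
  ring

theorem charpoly_eq_of_spec_eq {G H : SimpleGraph (Fin n)} (h : spec G = spec H) :
    (adj ℤ G).charpoly = (adj ℤ H).charpoly := by
  apply map_injective (Int.castRingHom ℂ) (RingHom.injective_int _)
  rw [← charpoly_adj, ← charpoly_adj]
  rw [(IsAlgClosed.splits (adj ℂ G).charpoly).eq_prod_roots_of_monic (Matrix.charpoly_monic _),
    (IsAlgClosed.splits (adj ℂ H).charpoly).eq_prod_roots_of_monic (Matrix.charpoly_monic _)]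
  unfold spec at h
  rw [h]

theorem GeneralizedCospectral.eq_card {m : ℕ} {G : SimpleGraph (Fin n)} {H : SimpleGraph (Fin m)}
    (h : GeneralizedCospectral G H) : n = m := by
  have h1 := congrArg Multiset.card h.1
  unfold spec at h1
  rwa [← (IsAlgClosed.splits _).natDegree_eq_card_roots,
    ← (IsAlgClosed.splits _).natDegree_eq_card_roots, Matrix.charpoly_natDegree_eq_dim,
    Matrix.charpoly_natDegree_eq_dim, Fintype.card_fin, Fintype.card_fin] at h1

variable {G H : SimpleGraph (Fin n)}

theorem GeneralizedCospectral.walkPoly_eq (h : GeneralizedCospectral G H) :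
    walkPoly (adj ℤ G) = walkPoly (adj ℤ H) := by
  refine Polynomial.funext fun s => ?_
  rw [eval_walkPoly, eval_walkPoly, charpoly_eq_of_spec_eq h.1, charpoly_eq_of_spec_eq h.2]

theorem GeneralizedCospectral.Mbar_eq (h : GeneralizedCospectral G H) (p : Nat.Primes) :
    Mbar G p = Mbar H p := by
  have h1 := charpoly_eq_of_spec_eq h.1
  have hJ : ∀ G : SimpleGraph (Fin n), (adj (ZMod p) G + Matrix.of fun _ _ => 1).charpoly =
      ((adj ℤ G).charpoly - walkPoly (adj ℤ G)).map (Int.castRingHom (ZMod p)) := by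
    intro G
    rw [← charpoly_add_of_one, ← Matrix.charpoly_map, ← adj_map G (Int.castRingHom (ZMod p))]
    congr 1
    ext i j
    simp
  unfold Mbar mainPoly psi
  rw [hJ, hJ, charpoly_adj G (R := ZMod p), charpoly_adj H (R := ZMod p), h1, h.walkPoly_eq]

theorem aeval_mulVec_one_eq {A B : Matrix (Fin n) (Fin n) ℤ} {k : ℕ} (f : ℤ[X])
    (hf : f.natDegree < k)
    (h : ∀ j < k, 1 ⬝ᵥ (A ^ j *ᵥ 1) = 1 ⬝ᵥ (B ^ j *ᵥ 1)) :
    1 ⬝ᵥ (aeval A f *ᵥ 1) = 1 ⬝ᵥ (aeval B f *ᵥ 1) := by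
  rw [aeval_eq_sum_range' hf, aeval_eq_sum_range' hf, Matrix.sum_mulVec, Matrix.sum_mulVec,
    dotProduct_sum, dotProduct_sum]
  refine Finset.sum_congr rfl fun i hi => ?_
  rw [Matrix.smul_mulVec, Matrix.smul_mulVec, dotProduct_smul, dotProduct_smul,
    h i (Finset.mem_range.mp hi)]

theorem natDegree_modByMonic_charpoly_lt [NeZero n] (A : Matrix (Fin n) (Fin n) ℤ) (f : ℤ[X]) :
    (f %ₘ A.charpoly).natDegree < n := by
  have h := natDegree_modByMonic_lt f A.charpoly_monic (fun h1 => by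
    have := congrArg natDegree h1
    rw [Matrix.charpoly_natDegree_eq_dim] at this
    simp [NeZero.ne n] at this)
  rwa [Matrix.charpoly_natDegree_eq_dim, Fintype.card_fin] at h

/-- The generalized spectrum determines the number of walks of each length. -/
theorem GeneralizedCospectral.walks_eq (h : GeneralizedCospectral G H) (k : ℕ) :
    1 ⬝ᵥ (adj ℤ G ^ k *ᵥ 1) = 1 ⬝ᵥ (adj ℤ H ^ k *ᵥ 1) := by
  rcases Nat.eq_zero_or_pos n with rfl | hn
  · simp
  have : NeZero n := ⟨hn.ne'⟩
  have hχ := charpoly_eq_of_spec_eq h.1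
  have hcoeff : ∀ A : Matrix (Fin n) (Fin n) ℤ, ∃ B, ∀ m ≥ B, ∀ k, (walkPoly A).coeff k =
      ∑ i ∈ Finset.range m, A.charpoly.coeff (k + 1 + i) * (1 ⬝ᵥ (A ^ i *ᵥ 1)) := by
    intro A
    obtain ⟨B, hB⟩ := coeff_adjugate_charmatrix A
    refine ⟨B, fun m hm k => ?_⟩
    have h1 := congrArg (fun M => 1 ⬝ᵥ (M *ᵥ 1)) (hB m hm k)
    simp only [Matrix.sum_mulVec, dotProduct_sum, Matrix.smul_mulVec, dotProduct_smul,
      smul_eq_mul] at h1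
    rw [← h1, walkPoly]
    simp [dotProduct, Matrix.mulVec]
  -- The coefficients of `walkPoly` form a unitriangular system in the walk counts: the coefficient
  -- at `n - 1 - k` involves lengths up to `k`, with the monic leading coefficient in front of
  -- length `k`.
  have hlt : ∀ k < n, 1 ⬝ᵥ (adj ℤ G ^ k *ᵥ 1) = 1 ⬝ᵥ (adj ℤ H ^ k *ᵥ 1) := by
    intro k
    induction k using Nat.strong_induction_on with
    | _ k ih =>
      intro hk
      have key : ∀ A : Matrix (Fin n) (Fin n) ℤ, (walkPoly A).coeff (n - 1 - k) =
          ∑ i ∈ Finset.range k, A.charpoly.coeff (n - 1 - k + 1 + i) * (1 ⬝ᵥ (A ^ i *ᵥ 1)) +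
            1 ⬝ᵥ (A ^ k *ᵥ 1) := by
        intro A
        have hdeg : A.charpoly.natDegree = n := by
          rw [Matrix.charpoly_natDegree_eq_dim, Fintype.card_fin]
        obtain ⟨B, hB⟩ := hcoeff A
        rw [hB (B + (k + 1)) (by omega), ← Finset.sum_subset (s₁ := Finset.range (k + 1)),
          Finset.sum_range_succ, show n - 1 - k + 1 + k = A.charpoly.natDegree by omega,
          Polynomial.coeff_natDegree, A.charpoly_monic.leadingCoeff, one_mul]
        · intro i hi
          simp only [Finset.mem_range] at *
          omega
        · intro i _ hi
          simp only [Finset.mem_range] at hi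
          rw [coeff_eq_zero_of_natDegree_lt (by omega), zero_mul]
      have h1 := key (adj ℤ G)
      rw [h.walkPoly_eq, key, hχ] at h1
      have h2 : ∀ i ∈ Finset.range k, (adj ℤ H).charpoly.coeff (n - 1 - k + 1 + i) *
          (1 ⬝ᵥ (adj ℤ G ^ i *ᵥ 1)) = (adj ℤ H).charpoly.coeff (n - 1 - k + 1 + i) *
          (1 ⬝ᵥ (adj ℤ H ^ i *ᵥ 1)) := by
        intro i hi
        have := Finset.mem_range.mp hi
        rw [ih i this (by omega)]
      rw [Finset.sum_congr rfl h2] at h1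
      exact (add_left_cancel h1).symm
  rw [Matrix.pow_eq_aeval_mod_charpoly, Matrix.pow_eq_aeval_mod_charpoly (adj ℤ H), hχ]
  exact aeval_mulVec_one_eq _ (natDegree_modByMonic_charpoly_lt _ _) hlt

/-- The walk matrix over the rationals. -/
noncomputable def walkMatrixRat (G : SimpleGraph (Fin n)) : Matrix (Fin n) (Fin n) ℚ :=
  (walkMatrix G).map (Int.castRingHom ℚ)

theorem cast_pow_mulVec_one (G : SimpleGraph (Fin n)) (k : ℕ) :
    Int.castRingHom ℚ ∘ (adj ℤ G ^ k *ᵥ 1) = adj ℚ G ^ k *ᵥ 1 := by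
  ext i
  have h1 : Int.castRingHom ℚ ∘ (1 : Fin n → ℤ) = 1 := by ext; simp
  rw [Function.comp_apply, RingHom.map_mulVec, ← adj_map G (Int.castRingHom ℚ), Matrix.map_pow, h1]

theorem walkMatrixRat_mulVec_single (G : SimpleGraph (Fin n)) (j : Fin n) :
    walkMatrixRat G *ᵥ Pi.single j 1 = adj ℚ G ^ (j : ℕ) *ᵥ 1 := by
  rw [← cast_pow_mulVec_one]
  ext i
  simp [walkMatrixRat, walkMatrix]

theorem det_walkMatrixRat_ne_zero (hG : Controllable G) : (walkMatrixRat G).det ≠ 0 := by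
  have h : (walkMatrixRat G).rank = n := hG
  intro h0
  obtain ⟨v, hv, hv0⟩ := Matrix.exists_mulVec_eq_zero_iff.mpr h0
  have hker := LinearMap.finrank_range_add_finrank_ker (walkMatrixRat G).mulVecLin
  rw [Matrix.rank] at h
  rw [h, Module.finrank_fin_fun, Nat.add_eq_left, Submodule.finrank_eq_zero] at hker
  have : v ∈ LinearMap.ker (walkMatrixRat G).mulVecLin := hv0
  rw [hker] at this
  exact hv this

theorem eq_of_mul_walkMatrixRat {M N : Matrix (Fin n) (Fin n) ℚ} (hG : Controllable G)
    (h : ∀ j : ℕ, j < n → M *ᵥ (adj ℚ G ^ j *ᵥ 1) = N *ᵥ (adj ℚ G ^ j *ᵥ 1)) : M = N := by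
  have hu := (det_walkMatrixRat_ne_zero hG).isUnit
  have h1 : M * walkMatrixRat G = N * walkMatrixRat G := by
    ext i j
    have := congrFun (h j j.2) i
    rw [← walkMatrixRat_mulVec_single, Matrix.mulVec_mulVec, Matrix.mulVec_mulVec] at this
    simpa using this
  rw [← Matrix.mul_nonsing_inv_cancel_right (walkMatrixRat G) M hu, h1,
    Matrix.mul_nonsing_inv_cancel_right _ _ hu]

/-- The entry `(i, j)` of `WᵀW` counts all walks of length `i + j`, hence the need for walk counts
beyond length `n - 1`. -/
theorem GeneralizedCospectral.gram_eq (h : GeneralizedCospectral G H) :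
    (walkMatrixRat G)ᵀ * walkMatrixRat G = (walkMatrixRat H)ᵀ * walkMatrixRat H := by
  have key : ∀ G : SimpleGraph (Fin n), (walkMatrix G)ᵀ * walkMatrix G =
      Matrix.of fun i j : Fin n => 1 ⬝ᵥ (adj ℤ G ^ ((i : ℕ) + (j : ℕ)) *ᵥ 1) := by
    intro G
    ext i j
    have h1 : (walkMatrix G)ᵀ i = adj ℤ G ^ (i : ℕ) *ᵥ 1 := rfl
    have h2 : (fun k => walkMatrix G k j) = adj ℤ G ^ (j : ℕ) *ᵥ 1 := rfl
    rw [Matrix.mul_apply', h1, h2, Matrix.of_apply, pow_add, ← Matrix.mulVec_mulVec,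
      Matrix.dotProduct_mulVec 1, ← Matrix.mulVec_transpose, ((isSymm_adj G ℤ).pow _).eq]
  rw [walkMatrixRat, walkMatrixRat, ← Matrix.transpose_map, ← Matrix.transpose_map,
    ← Matrix.map_mul, ← Matrix.map_mul, key, key]
  congr 2
  ext i j
  exact h.walks_eq _

/-- A controllable graph and a generalized cospectral graph are related by a rational orthogonal
matrix that fixes the all-ones vector. -/
theorem GeneralizedCospectral.exists_orthogonal (h : GeneralizedCospectral G H)
    (hG : Controllable G) : ∃ Q : Matrix (Fin n) (Fin n) ℚ, Qᵀ * Q = 1 ∧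
      adj ℚ G * Q = Q * adj ℚ H ∧ Qᵀ *ᵥ 1 = 1 := by
  have hgram := h.gram_eq
  have hdG := det_walkMatrixRat_ne_zero hG
  have hdH : IsUnit (walkMatrixRat H).det := by
    have := congrArg Matrix.det hgram
    rw [Matrix.det_mul, Matrix.det_mul, Matrix.det_transpose, Matrix.det_transpose] at this
    refine IsUnit.mk0 _ fun h0 => hdG ?_
    rw [h0, zero_mul] at this
    exact mul_self_eq_zero.mp this
  set Q := walkMatrixRat G * (walkMatrixRat H)⁻¹ with hQ
  have hQW : Q * walkMatrixRat H = walkMatrixRat G := by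
    rw [hQ, Matrix.nonsing_inv_mul_cancel_right _ _ hdH]
  have hQQ : Qᵀ * Q = 1 := by
    rw [hQ, Matrix.transpose_mul, Matrix.mul_assoc, ← Matrix.mul_assoc (walkMatrixRat G)ᵀ, hgram,
      Matrix.mul_assoc, Matrix.mul_nonsing_inv _ hdH, Matrix.mul_one, ← Matrix.transpose_mul,
      Matrix.mul_nonsing_inv _ hdH, Matrix.transpose_one]
  have hlt : ∀ j < n, Q *ᵥ (adj ℚ H ^ j *ᵥ 1) = adj ℚ G ^ j *ᵥ 1 := by
    intro j hj
    have h1 := walkMatrixRat_mulVec_single H ⟨j, hj⟩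
    have h2 := walkMatrixRat_mulVec_single G ⟨j, hj⟩
    simp only at h1 h2
    rw [← h1, ← h2, Matrix.mulVec_mulVec, hQW]
  -- By Cayley–Hamilton with the common characteristic polynomial. The intertwining relation below
  -- needs the case `j = n`, which the walk matrices do not contain.
  have hall : ∀ j, Q *ᵥ (adj ℚ H ^ j *ᵥ 1) = adj ℚ G ^ j *ᵥ 1 := by
    intro j
    rcases Nat.eq_zero_or_pos n with rfl | hn
    · exact Subsingleton.elim _ _
    have : NeZero n := ⟨hn.ne'⟩
    have hχ : (adj ℚ G).charpoly = (adj ℚ H).charpoly := by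
      rw [charpoly_adj G, charpoly_adj H, charpoly_eq_of_spec_eq h.1]
    have hdeg : (X ^ j %ₘ (adj ℚ H).charpoly).natDegree < n := by
      have h3 : (X ^ j %ₘ (adj ℚ H).charpoly) =
          (X ^ j %ₘ (adj ℤ H).charpoly).map (Int.castRingHom ℚ) := by
        rw [map_modByMonic _ (Matrix.charpoly_monic _), ← charpoly_adj H]
        simp
      rw [h3]
      exact natDegree_map_le.trans_lt (natDegree_modByMonic_charpoly_lt _ _)
    rw [Matrix.pow_eq_aeval_mod_charpoly, Matrix.pow_eq_aeval_mod_charpoly (adj ℚ G), hχ,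
      aeval_eq_sum_range' hdeg, aeval_eq_sum_range' hdeg, Matrix.sum_mulVec, Matrix.sum_mulVec,
      Matrix.mulVec_sum]
    refine Finset.sum_congr rfl fun i hi => ?_
    rw [Matrix.smul_mulVec, Matrix.smul_mulVec, Matrix.mulVec_smul, hlt i (Finset.mem_range.mp hi)]
  have hH : Controllable H := by
    have h4 := Matrix.rank_of_isUnit _ ((Matrix.isUnit_iff_isUnit_det _).mpr hdH)
    rw [Fintype.card_fin] at h4
    exact h4
  refine ⟨Q, hQQ, ?_, ?_⟩
  · refine eq_of_mul_walkMatrixRat hH fun j _ => ?_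
    rw [← Matrix.mulVec_mulVec, hall, ← Matrix.mulVec_mulVec, Matrix.mulVec_mulVec, ← pow_succ',
      Matrix.mulVec_mulVec (v := 1), ← pow_succ', hall]
  · have h1 : Q *ᵥ 1 = 1 := by simpa using hall 0
    nth_rewrite 1 [← h1]
    rw [Matrix.mulVec_mulVec, hQQ, Matrix.one_mulVec]

end GeneralizedSpectrum

/-! ### Bounding the denominator of `Q`. -/

section Integrality

variable {n : ℕ}

/-- Every invariant factor divides the last, so `d_n` clears the denominators of the inverse of the
Smith form, and unimodular factors preserve integrality. -/
theorem exists_mul_eq_invariantFactor (hn : 0 < n) {M : Matrix (Fin n) (Fin n) ℤ}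
    (hM : M.det ≠ 0) : invariantFactor M n ≠ 0 ∧
      ∃ Y : Matrix (Fin n) (Fin n) ℤ, M * Y = (invariantFactor M n : ℤ) • 1 := by
  have hs := (exists_isSmithNormalForm M).choose_spec
  rw [invariantFactor, dif_pos ⟨hn, le_rfl⟩]
  generalize (exists_isSmithNormalForm M).choose = d at hs ⊢
  obtain ⟨⟨U, V, hU, hV, hUV⟩, hd⟩ := hs
  set l : Fin n := ⟨n - 1, by omega⟩
  have hdl : ∀ i, d i ∣ d l := fun i => hd i l (Fin.mk_le_mk.mpr (by omega))
  have hdet := congrArg Matrix.det hUV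
  rw [Matrix.det_mul, Matrix.det_mul, Matrix.det_diagonal] at hdet
  have hl0 : d l ≠ 0 := by
    intro h0
    rw [Finset.prod_eq_zero (Finset.mem_univ l) (by exact_mod_cast h0), mul_eq_zero,
      mul_eq_zero] at hdet
    rw [Matrix.isUnit_iff_isUnit_det] at hU hV
    rcases hdet with (h | h) | h
    · exact hU.ne_zero h
    · exact hM h
    · exact hV.ne_zero h
  refine ⟨hl0, V * Matrix.diagonal (fun i => ((d l / d i : ℕ) : ℤ)) * U, ?_⟩
  obtain ⟨U', hU'⟩ := hU.exists_left_inv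
  have h1 : U * M * V * Matrix.diagonal (fun i => ((d l / d i : ℕ) : ℤ)) = (d l : ℤ) • 1 := by
    rw [hUV, Matrix.diagonal_mul_diagonal, ← Matrix.diagonal_one, ← Matrix.diagonal_smul]
    congr 1
    ext i
    rw [Pi.smul_apply, smul_eq_mul, mul_one]
    exact_mod_cast Nat.mul_div_cancel' (hdl i)
  calc M * (V * Matrix.diagonal (fun i => ((d l / d i : ℕ) : ℤ)) * U)
      = U' * (U * M * V * Matrix.diagonal (fun i => ((d l / d i : ℕ) : ℤ))) * U := by
        simp only [← Matrix.mul_assoc, hU', Matrix.one_mul]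
    _ = (d l : ℤ) • 1 := by rw [h1, Matrix.mul_smul, Matrix.mul_one, Matrix.smul_mul, hU']

theorem den_dvd_of_isIntegral {Q : Matrix (Fin n) (Fin n) ℚ} {d : ℕ}
    (h : ∀ i j, ∃ z : ℤ, (d : ℚ) * Q i j = z) : Q.den ∣ d := by
  rw [Matrix.den_dvd_iff]
  intro i j
  obtain ⟨z, hz⟩ := h i j
  generalize Q i j = q at hz
  rw [← Int.natCast_dvd_natCast]
  have h5 : q.num * d = z * q.den := by
    have hq0 : (q.den : ℚ) ≠ 0 := by exact_mod_cast q.den_ne_zero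
    rw [← Rat.num_div_den q] at hz
    field_simp at hz
    have h6 : (d * q.num : ℤ) = q.den * z := by exact_mod_cast hz
    linarith
  have hco : IsCoprime (q.den : ℤ) q.num := by
    rw [Int.isCoprime_iff_nat_coprime]
    simpa using q.reduced.symm
  exact hco.dvd_of_dvd_mul_left ⟨z, by rw [h5, mul_comm]⟩

theorem num_map_eq (Q : Matrix (Fin n) (Fin n) ℚ) :
    Q.num.map (Int.castRingHom ℚ) = (Q.den : ℚ) • Q := by
  ext i j
  have h0 : (Q.den : ℚ) ≠ 0 := by exact_mod_cast Q.den_ne_zero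
  have := Matrix.num_div_den Q i j
  rw [Matrix.smul_apply, smul_eq_mul, ← this]
  field_simp
  simp

/-- If `M Y = d_n`, then `d_n Q = Yᵀ Mᵀ Q = (N Y)ᵀ` is integral. -/
theorem den_dvd_invariantFactor (hn : 0 < n) {M N : Matrix (Fin n) (Fin n) ℤ} (hM : M.det ≠ 0)
    {Q : Matrix (Fin n) (Fin n) ℚ}
    (h : (M.map (Int.castRingHom ℚ))ᵀ * Q = (N.map (Int.castRingHom ℚ))ᵀ) :
    Q.den ∣ invariantFactor M n := by
  obtain ⟨-, Y, hY⟩ := exists_mul_eq_invariantFactor hn hM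
  generalize invariantFactor M n = d at hY
  have h1 : (d : ℚ) • Q = ((N * Y).map (Int.castRingHom ℚ))ᵀ := by
    have h2 := congrArg (fun M => (M.map (Int.castRingHom ℚ))ᵀ) hY
    simp only [Matrix.map_mul, Matrix.transpose_mul] at h2
    have h3 : ((((d : ℤ) • 1 : Matrix (Fin n) (Fin n) ℤ)).map (Int.castRingHom ℚ))ᵀ = (d : ℚ) • 1 := by
      ext i j
      rw [Matrix.transpose_apply, Matrix.map_apply, Matrix.smul_apply, Matrix.smul_apply,
        smul_eq_mul, map_mul, smul_eq_mul, Matrix.one_apply, Matrix.one_apply]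
      simp [eq_comm]
    rw [h3] at h2
    rw [Matrix.map_mul, Matrix.transpose_mul, ← h, ← Matrix.mul_assoc, h2, Matrix.smul_mul,
      Matrix.one_mul]
  refine den_dvd_of_isIntegral fun i j => ⟨(N * Y) j i, ?_⟩
  have h4 := congrFun (congrFun h1 i) j
  rwa [Matrix.smul_apply, smul_eq_mul, Matrix.transpose_apply, Matrix.map_apply] at h4

theorem Mpoly_map (G : SimpleGraph (Fin n)) (p : Nat.Primes) :
    (Mpoly G p).map (Int.castRingHom (ZMod p)) = Mbar G p := by
  rw [Mpoly, Polynomial.map_sum]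
  conv_rhs => rw [(Mbar G p).as_sum_range_C_mul_X_pow]
  refine Finset.sum_congr rfl fun i _ => ?_
  rw [Polynomial.map_mul, Polynomial.map_pow, map_X, map_C]
  rw [eq_intCast, Int.cast_natCast, ZMod.natCast_zmod_val]

theorem Mpoly_ne_zero (G : SimpleGraph (Fin n)) (p : Nat.Primes) : Mpoly G p ≠ 0 := by
  intro h
  apply (Mbar_spec G p).2
  rw [← Mpoly_map, h, Polynomial.map_zero]

theorem dvd_aeval_Mpoly_mulVec (G : SimpleGraph (Fin n)) (p : Nat.Primes) (i : Fin n) :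
    ((p : ℕ) : ℤ) ∣ (aeval (adj ℤ G) (Mpoly G p) *ᵥ 1) i := by
  rw [← ZMod.intCast_zmod_eq_zero_iff_dvd]
  have h := congrFun (Mbar_spec G p).1 i
  have h1 : Int.castRingHom (ZMod p) ∘ (1 : Fin n → ℤ) = 1 := by ext; simp
  rw [← Mpoly_map, ← adj_map G (Int.castRingHom (ZMod p)), ← map_aeval_matrix, ← h1,
    ← RingHom.map_mulVec] at h
  exact h

/-- The polynomial `f_j` such that column `j` of `W^(p)(G)` is `f_j(A) e` divided by `1` or `p`. -/
noncomputable def columnPoly (G : SimpleGraph (Fin n)) (p : Nat.Primes) (j : ℕ) : ℤ[X] :=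
  if j < (Mpoly G p).natDegree then X ^ j else X ^ (j - (Mpoly G p).natDegree) * Mpoly G p

/-- The denominator of column `j` of `W^(p)(G)`. -/
noncomputable def columnDen (G : SimpleGraph (Fin n)) (p : Nat.Primes) (j : ℕ) : ℤ :=
  if j < (Mpoly G p).natDegree then 1 else p

theorem columnDen_ne_zero (G : SimpleGraph (Fin n)) (p : Nat.Primes) (j : ℕ) :
    columnDen G p j ≠ 0 := by
  unfold columnDen
  split_ifs
  · exact one_ne_zero
  · exact_mod_cast p.2.ne_zero

theorem columnDen_mul_modifiedWalkMatrix (G : SimpleGraph (Fin n)) (p : Nat.Primes) (i j : Fin n) :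
    columnDen G p j * modifiedWalkMatrix G p i j =
      (aeval (adj ℤ G) (columnPoly G p j) *ᵥ 1) i := by
  rw [columnDen, modifiedWalkMatrix, columnPoly, Matrix.of_apply]
  split_ifs with h
  · simp
  · rw [map_mul, map_pow, aeval_X]
    refine Int.mul_ediv_cancel' ?_
    rw [← Matrix.mulVec_mulVec, Matrix.mulVec, dotProduct]
    exact Finset.dvd_sum fun k _ => Dvd.dvd.mul_left (dvd_aeval_Mpoly_mulVec G p k) _

theorem natDegree_columnPoly (G : SimpleGraph (Fin n)) (p : Nat.Primes) (j : ℕ) :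
    columnPoly G p j ≠ 0 ∧ (columnPoly G p j).natDegree = j := by
  have h0 := Mpoly_ne_zero G p
  unfold columnPoly
  split_ifs with h
  · exact ⟨pow_ne_zero _ X_ne_zero, natDegree_X_pow j⟩
  · refine ⟨mul_ne_zero (pow_ne_zero _ X_ne_zero) h0, ?_⟩
    rw [natDegree_mul (pow_ne_zero _ X_ne_zero) h0, natDegree_X_pow]
    omega

theorem det_walkMatrix_ne_zero {G : SimpleGraph (Fin n)} (hG : Controllable G) :
    (walkMatrix G).det ≠ 0 := by
  intro h
  apply det_walkMatrixRat_ne_zero hG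
  rw [walkMatrixRat, ← RingHom.mapMatrix_apply, ← RingHom.map_det, h, map_zero]

/-- Column `j` is, up to a nonzero scalar, a polynomial of degree exactly `j` in `A` applied to `e`,
so the passage from `W(G)` is triangular with nonzero diagonal. -/
theorem det_modifiedWalkMatrix_ne_zero {G : SimpleGraph (Fin n)} (hG : Controllable G)
    (p : Nat.Primes) : (modifiedWalkMatrix G p).det ≠ 0 := by
  intro h
  obtain ⟨y, hy, hy0⟩ := Matrix.exists_vecMul_eq_zero_iff.mpr h
  have h1 : ∀ j < n, y ⬝ᵥ (aeval (adj ℤ G) (columnPoly G p j) *ᵥ 1) = 0 := by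
    intro j hj
    have h2 := congrArg (columnDen G p j * ·) (congrFun hy0 ⟨j, hj⟩)
    simp only [Matrix.vecMul, dotProduct, Finset.mul_sum, Pi.zero_apply, mul_zero] at h2
    rw [dotProduct, ← h2]
    refine Finset.sum_congr rfl fun i _ => ?_
    have h3 := columnDen_mul_modifiedWalkMatrix G p i ⟨j, hj⟩
    simp only at h3
    rw [← h3]
    ring
  have h4 : ∀ j < n, y ⬝ᵥ (adj ℤ G ^ j *ᵥ 1) = 0 := by
    intro j
    induction j using Nat.strong_induction_on with
    | _ j ih =>
      intro hj
      have h5 := h1 j hj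
      obtain ⟨hne, hdeg⟩ := natDegree_columnPoly G p j
      rw [aeval_eq_sum_range, hdeg, Finset.sum_range_succ, Matrix.add_mulVec, Matrix.sum_mulVec,
        dotProduct_add, dotProduct_sum, Finset.sum_eq_zero, zero_add, Matrix.smul_mulVec,
        dotProduct_smul, smul_eq_mul, mul_eq_zero] at h5
      · refine h5.resolve_left ?_
        nth_rewrite 2 [← hdeg]
        exact leadingCoeff_ne_zero.mpr hne
      · intro k hk
        have := Finset.mem_range.mp hk
        rw [Matrix.smul_mulVec, dotProduct_smul, ih k this (by omega), smul_zero]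
  apply det_walkMatrix_ne_zero hG
  refine Matrix.exists_vecMul_eq_zero_iff.mp ⟨y, hy, ?_⟩
  ext j
  exact h4 j j.2

variable {G H : SimpleGraph (Fin n)} {Q : Matrix (Fin n) (Fin n) ℚ}

theorem transpose_mulVec_aeval (hAQ : adj ℚ G * Q = Q * adj ℚ H)
    (hQe : Qᵀ *ᵥ 1 = 1) (f : ℤ[X]) :
    Qᵀ *ᵥ (Int.castRingHom ℚ ∘ (aeval (adj ℤ G) f *ᵥ 1)) =
      Int.castRingHom ℚ ∘ (aeval (adj ℤ H) f *ᵥ 1) := by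
  have hcast : ∀ G : SimpleGraph (Fin n), Int.castRingHom ℚ ∘ (aeval (adj ℤ G) f *ᵥ 1) =
      aeval (adj ℚ G) (f.map (Int.castRingHom ℚ)) *ᵥ 1 := by
    intro G
    have h1 : Int.castRingHom ℚ ∘ (1 : Fin n → ℤ) = 1 := by ext; simp
    rw [← adj_map G (Int.castRingHom ℚ), ← map_aeval_matrix, ← h1]
    exact _root_.funext (RingHom.map_mulVec _ _ _)
  have hA : adj ℚ H * Qᵀ = Qᵀ * adj ℚ G := by
    have := congrArg Matrix.transpose hAQ
    rwa [Matrix.transpose_mul, Matrix.transpose_mul, (isSymm_adj G ℚ).eq, (isSymm_adj H ℚ).eq,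
      eq_comm] at this
  rw [hcast, hcast, Matrix.mulVec_mulVec, ← aeval_mul_comm hA, ← Matrix.mulVec_mulVec, hQe]

theorem transpose_mul_of_columns {M N : Matrix (Fin n) (Fin n) ℤ} {f : ℕ → ℤ[X]} {c : ℕ → ℤ}
    (hc : ∀ j, c j ≠ 0) (hM : ∀ i j : Fin n, c j * M i j = (aeval (adj ℤ G) (f j) *ᵥ 1) i)
    (hN : ∀ i j : Fin n, c j * N i j = (aeval (adj ℤ H) (f j) *ᵥ 1) i)
    (hAQ : adj ℚ G * Q = Q * adj ℚ H) (hQe : Qᵀ *ᵥ 1 = 1) :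
    (M.map (Int.castRingHom ℚ))ᵀ * Q = (N.map (Int.castRingHom ℚ))ᵀ := by
  ext j i
  have h := congrFun (transpose_mulVec_aeval hAQ hQe (f j)) i
  have hc' : (c j : ℚ) ≠ 0 := by exact_mod_cast hc j
  apply mul_left_cancel₀ hc'
  simp only [Matrix.mulVec, dotProduct, Function.comp_apply, Matrix.transpose_apply] at h hM hN
  rw [Matrix.mul_apply, Finset.mul_sum]
  simp only [Matrix.transpose_apply, Matrix.map_apply]
  have h2 : (c j : ℚ) * Int.castRingHom ℚ (N i j) = Int.castRingHom ℚ (c j * N i j) := by simp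
  rw [h2, hN, ← h]
  refine Finset.sum_congr rfl fun k _ => ?_
  rw [← hM]
  simp
  ring

theorem modifiedWalkMatrix_transpose_mul (hM : ∀ p, Mbar G p = Mbar H p) (p : Nat.Primes)
    (hAQ : adj ℚ G * Q = Q * adj ℚ H) (hQe : Qᵀ *ᵥ 1 = 1) :
    ((modifiedWalkMatrix G p).map (Int.castRingHom ℚ))ᵀ * Q =
      ((modifiedWalkMatrix H p).map (Int.castRingHom ℚ))ᵀ := by
  have hMp : Mpoly G p = Mpoly H p := by rw [Mpoly, Mpoly, hM p]
  refine transpose_mul_of_columns (columnDen_ne_zero G p) (columnDen_mul_modifiedWalkMatrix G p) ?_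
    hAQ hQe
  intro i j
  have h := columnDen_mul_modifiedWalkMatrix H p i j
  rw [columnDen, columnPoly, ← hMp] at h
  rw [columnDen, columnPoly]
  exact h

theorem walkMatrix_transpose_mul (hAQ : adj ℚ G * Q = Q * adj ℚ H) (hQe : Qᵀ *ᵥ 1 = 1) :
    ((walkMatrix G).map (Int.castRingHom ℚ))ᵀ * Q = ((walkMatrix H).map (Int.castRingHom ℚ))ᵀ :=
  transpose_mul_of_columns (f := fun j => X ^ j) (c := fun _ => 1) (fun _ => one_ne_zero)
    (fun i j => by simp [walkMatrix]) (fun i j => by simp [walkMatrix]) hAQ hQe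

theorem finite_setOf_isPotential (hn : 0 < n) (hG : Controllable G) :
    {p | IsPotential G p}.Finite := by
  have h0 := (exists_mul_eq_invariantFactor hn (det_walkMatrix_ne_zero hG)).1
  refine Set.Finite.subset (Set.Finite.preimage Subtype.val_injective.injOn
    ((Set.finite_le_nat (invariantFactor (walkMatrix G) n + 2)))) fun p hp => ?_
  by_cases h2 : (p : ℕ) = 2
  · exact (show (p : ℕ) ≤ _ by omega)
  · have h3 := (hp.2 h2).1
    have h4 : (p : ℕ) ∣ invariantFactor (walkMatrix G) n := by
      have := Int.gcd_dvd_right (graphDiscr G) (invariantFactor (walkMatrix G) n : ℤ)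
      exact h3.trans (by exact_mod_cast this)
    exact (show (p : ℕ) ≤ _ from (Nat.le_of_dvd (Nat.pos_of_ne_zero h0) h4).trans (by omega))

theorem level_pos (G : SimpleGraph (Fin n)) : 0 < level G := by
  unfold level
  refine finprod_induction (fun k => 0 < k) one_pos (fun _ _ => Nat.mul_pos) fun p => ?_
  exact finprod_induction (fun k => 0 < k) one_pos (fun _ _ => Nat.mul_pos)
    fun _ => Nat.pow_pos p.2.pos

theorem pow_texp_dvd_level (hn : 0 < n) (hG : Controllable G) {p : Nat.Primes}
    (hp : IsPotential G p) : (p : ℕ) ^ texp G p ∣ level G := by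
  have hfin := finite_setOf_isPotential hn hG
  have h : level G = ∏ q ∈ hfin.toFinset, (q : ℕ) ^ texp G q :=
    finprod_mem_eq_finite_toFinset_prod (fun q : Nat.Primes => (q : ℕ) ^ texp G q) hfin
  rw [h]
  exact Finset.dvd_prod_of_mem (fun q : Nat.Primes => (q : ℕ) ^ texp G q)
    (hfin.mem_toFinset.mpr hp)

theorem sq_dvd_graphDiscr (hQQ : Qᵀ * Q = 1) (hAQ : adj ℚ G * Q = Q * adj ℚ H) {p : ℕ}
    (hp : p.Prime) (hpQ : p ∣ Q.den) : (p : ℤ) ^ 2 ∣ graphDiscr G := by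
  have hinj : Function.Injective (Int.castRingHom ℚ) := (Int.castRingHom ℚ).injective_int
  have hX := num_map_eq Q
  refine sq_dvd_discr_charpoly (A := adj ℤ G) (B := adj ℤ H) (X := Q.num) (l := Q.den)
    (isSymm_adj G ℤ) ?_ ?_ hp (by exact_mod_cast hpQ) ?_
  · apply Matrix.map_injective hinj
    simp only [Matrix.map_mul, hX, adj_map, Matrix.mul_smul, Matrix.smul_mul, hAQ]
  · apply Matrix.map_injective hinj
    simp only [Matrix.map_mul, Matrix.transpose_map, hX, Matrix.mul_smul, Matrix.smul_mul, hQQ,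
      Matrix.transpose_smul]
    ext i j
    rw [Matrix.map_apply]
    simp only [Matrix.smul_apply, smul_eq_mul, map_mul, sq, Matrix.one_apply]
    split_ifs <;> simp
  -- If `p` divided every entry of `Q.num`, then `Q.den / p` would already be a common denominator
  -- of `Q`.
  · intro hall
    obtain ⟨d, hd⟩ := hpQ
    have hden : Q.den ∣ d := by
      refine den_dvd_of_isIntegral fun i j => ?_
      obtain ⟨z, hz⟩ := hall i j
      have h1 := congrFun (congrFun hX i) j
      have hp0 : (p : ℚ) ≠ 0 := by exact_mod_cast hp.ne_zero
      rw [Matrix.map_apply, hz, Matrix.smul_apply, smul_eq_mul, hd] at h1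
      refine ⟨z, mul_left_cancel₀ hp0 ?_⟩
      push_cast at h1
      rw [← mul_assoc, ← h1]
      simp
    have := Nat.le_of_dvd (Nat.pos_of_ne_zero fun h => Q.den_ne_zero (by rw [hd, h, mul_zero])) hden
    have h2 := hp.two_le
    have h3 := Nat.pos_of_ne_zero Q.den_ne_zero
    nlinarith

/-- For a prime power dividing the denominator, `W^(p)` bounds its exponent by `t_p`, while `W` and
the discriminant show that `p` is potential, so `p ^ t_p` occurs in `L`. -/
theorem den_dvd_level (hn : 0 < n) (hG : Controllable G) (hM : ∀ p, Mbar G p = Mbar H p)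
    (hQQ : Qᵀ * Q = 1) (hAQ : adj ℚ G * Q = Q * adj ℚ H) (hQe : Qᵀ *ᵥ 1 = 1) :
    Q.den ∣ level G := by
  rw [Nat.dvd_iff_prime_pow_dvd_dvd]
  intro p k hp hpk
  rcases Nat.eq_zero_or_pos k with rfl | hk
  · simp
  have hpQ : p ∣ Q.den := (dvd_pow_self p hk.ne').trans hpk
  set P : Nat.Primes := ⟨p, hp⟩ with hP
  have hdet := det_modifiedWalkMatrix_ne_zero hG P
  have h1 := den_dvd_invariantFactor hn hdet (modifiedWalkMatrix_transpose_mul hM P hAQ hQe)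
  have h0 := (exists_mul_eq_invariantFactor hn hdet).1
  have hkt : k ≤ texp G P := by
    have : Fact p.Prime := ⟨hp⟩
    exact (padicValNat_dvd_iff_le h0).mp (hpk.trans h1)
  have hpot : IsPotential G P := by
    refine ⟨hk.trans_le hkt, fun _ => ?_⟩
    have hsq := sq_dvd_graphDiscr hQQ hAQ hp hpQ
    refine ⟨?_, hsq⟩
    have hW := den_dvd_invariantFactor hn (det_walkMatrix_ne_zero hG)
      (walkMatrix_transpose_mul hAQ hQe)
    exact Int.dvd_gcd ((dvd_pow_self _ two_ne_zero).trans hsq)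
      (by exact_mod_cast hpQ.trans hW)
  exact (pow_dvd_pow p hkt).trans (pow_texp_dvd_level hn hG hpot)

end Integrality

/-! ### From mates to solutions and back. -/

section Mates

variable {n : ℕ} {G H : SimpleGraph (Fin n)}

/-- An integral orthogonal matrix fixing the all-ones vector is a permutation matrix. -/
theorem exists_perm_of_orthogonal {P : Matrix (Fin n) (Fin n) ℤ} (hPP : Pᵀ * P = 1)
    (hPe : Pᵀ *ᵥ 1 = 1) : ∃ σ : Equiv.Perm (Fin n), ∀ v i, P v i = if v = σ i then 1 else 0 := by
  have hcol : ∀ i, ∃ w, ∀ v, P v i = if v = w then 1 else 0 := by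
    intro i
    have hsq : ∑ v, P v i * P v i = 1 := by
      simpa [Matrix.mul_apply] using congrFun (congrFun hPP i) i
    have hsum : ∑ v, P v i = 1 := by
      simpa [Matrix.mulVec, dotProduct] using congrFun hPe i
    -- Integers satisfy `x² ≥ x`; as a column has sum of squares and sum both equal to 1, equality
    -- holds throughout and the entries are 0 or 1.
    have hnn : ∀ v ∈ Finset.univ, 0 ≤ P v i * P v i - P v i := by
      intro v _
      have : 0 ≤ P v i * (P v i - 1) := by
        rcases le_or_gt (P v i) 0 with h | h
        · exact mul_nonneg_of_nonpos_of_nonpos h (by omega)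
        · exact mul_nonneg h.le (by omega)
      linarith
    have h0 : ∀ v, P v i * P v i - P v i = 0 := fun v =>
      (Finset.sum_eq_zero_iff_of_nonneg hnn).mp
        (by rw [Finset.sum_sub_distrib, hsq, hsum, sub_self]) v (Finset.mem_univ v)
    have h01 : ∀ v, P v i = 0 ∨ P v i = 1 := by
      intro v
      have : P v i * (P v i - 1) = 0 := by linarith [h0 v]
      rcases mul_eq_zero.mp this with h | h
      · exact Or.inl h
      · exact Or.inr (by linarith)
    obtain ⟨w, -, hw⟩ := Finset.exists_ne_zero_of_sum_ne_zero (by rw [hsum]; exact one_ne_zero)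
    have hw1 := (h01 w).resolve_left hw
    refine ⟨w, fun v => ?_⟩
    split_ifs with h
    · rw [h, hw1]
    · have h2 := Finset.add_sum_erase Finset.univ (fun v => P v i) (Finset.mem_univ w)
      rw [hsum, hw1, add_eq_left] at h2
      refine (Finset.sum_eq_zero_iff_of_nonneg fun u _ => ?_).mp h2 v (by simp [h])
      rcases h01 u with h3 | h3 <;> simp [h3]
  choose σ hσ using hcol
  have hinj : Function.Injective σ := by
    intro i j hij
    by_contra hne
    have h1 := congrFun (congrFun hPP i) j
    rw [Matrix.mul_apply, Matrix.one_apply_ne hne] at h1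
    simp [hσ, hij] at h1
  exact ⟨Equiv.ofBijective σ (Finite.injective_iff_bijective.mp hinj), fun v i => hσ i v⟩

theorem adj_eq_iff {R : Type*} [CommRing R] (G : SimpleGraph (Fin n)) (i j : Fin n) [Decidable (G.Adj i j)] :
    adj R G i j = if G.Adj i j then 1 else 0 := by
  classical
  simp [adj, SimpleGraph.adjMatrix_apply]

/-- A rational orthogonal matrix relating `G` and `H` is not integral unless `G ≃g H`. -/
theorem nonempty_iso_of_integral {P : Matrix (Fin n) (Fin n) ℤ} (hPP : Pᵀ * P = 1)
    (hPe : Pᵀ *ᵥ 1 = 1) (hAP : Pᵀ * adj ℤ G * P = adj ℤ H) : Nonempty (G ≃g H) := by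
  classical
  obtain ⟨σ, hσ⟩ := exists_perm_of_orthogonal hPP hPe
  refine ⟨RelIso.symm ⟨σ, fun {i j} => ?_⟩⟩
  have h := congrFun (congrFun hAP i) j
  simp only [Matrix.mul_apply, Matrix.transpose_apply, hσ, ite_mul, one_mul, zero_mul, mul_ite,
    mul_one, mul_zero, Finset.sum_ite_eq', Finset.mem_univ, if_true] at h
  rw [adj_eq_iff, adj_eq_iff] at h
  split_ifs at h <;> simp_all

theorem exists_solutions_of_mate (hG : Controllable G) (h : IsGeneralizedCospectralMate G H) :
    ∃ ξ : Fin n → Fin n → ℤ, (∀ i, IsSolution G (ξ i)) ∧ (∃ i, IsNontrivial G (ξ i)) ∧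
      ∀ i j, i ≠ j → ξ i ⬝ᵥ ξ j = 0 ∧
        ξ i ⬝ᵥ (adj ℤ G *ᵥ ξ j) ∈ ({0, (level G : ℤ) ^ 2} : Set ℤ) := by
  classical
  obtain ⟨hcos, hiso⟩ := h
  rcases Nat.eq_zero_or_pos n with rfl | hn
  · rw [Subsingleton.elim H G] at hiso
    exact hiso.elim SimpleGraph.Iso.refl
  obtain ⟨Q, hQQ, hAQ, hQe⟩ := hcos.exists_orthogonal hG
  have hden := den_dvd_level hn hG hcos.Mbar_eq hQQ hAQ hQe
  have hL0 := (level_pos G).ne'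
  set L := level G with hL
  have hLQ : (L : ℚ) ≠ 0 := by exact_mod_cast hL0
  have hinj : Function.Injective (Int.castRingHom ℚ) := (Int.castRingHom ℚ).injective_int
  obtain ⟨X, hX⟩ : ∃ X : Matrix (Fin n) (Fin n) ℤ, X.map (Int.castRingHom ℚ) = (L : ℚ) • Q := by
    obtain ⟨d, hd⟩ := hden
    refine ⟨(d : ℤ) • Q.num, ?_⟩
    have := num_map_eq Q
    ext i j
    have h1 := congrFun (congrFun this i) j
    simp only [Matrix.map_apply, Matrix.smul_apply, smul_eq_mul, map_mul] at h1 ⊢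
    rw [h1, hd, eq_intCast]
    push_cast
    ring
  have hQAQ : Qᵀ * adj ℚ G * Q = adj ℚ H := by
    rw [Matrix.mul_assoc, hAQ, ← Matrix.mul_assoc, hQQ, Matrix.one_mul]
  have hXX : Xᵀ * X = ((L : ℤ) ^ 2) • 1 := by
    apply Matrix.map_injective hinj
    simp only [Matrix.map_mul, Matrix.transpose_map, hX, Matrix.mul_smul, Matrix.smul_mul, hQQ,
      Matrix.transpose_smul]
    ext i j
    rw [Matrix.map_apply]
    simp only [Matrix.smul_apply, smul_eq_mul, map_mul, sq, Matrix.one_apply]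
    split_ifs <;> simp
  have hXAX : Xᵀ * adj ℤ G * X = ((L : ℤ) ^ 2) • adj ℤ H := by
    apply Matrix.map_injective hinj
    simp only [Matrix.map_mul, Matrix.transpose_map, hX, Matrix.mul_smul, Matrix.smul_mul, adj_map,
      Matrix.transpose_smul, hQAQ]
    ext i j
    rw [Matrix.map_apply]
    simp only [Matrix.smul_apply, smul_eq_mul, map_mul, sq, ← adj_map H (Int.castRingHom ℚ),
      Matrix.map_apply]
    simp [mul_assoc]
  have hXe : Xᵀ *ᵥ 1 = (L : ℤ) • 1 := by
    ext i
    apply hinj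
    rw [RingHom.map_mulVec, Matrix.transpose_map, hX, Matrix.transpose_smul, Matrix.smul_mulVec,
      show Int.castRingHom ℚ ∘ (1 : Fin n → ℤ) = 1 by ext; simp, hQe]
    simp
  have hform : ∀ i j, Xᵀ i ⬝ᵥ (adj ℤ G *ᵥ Xᵀ j) = (L : ℤ) ^ 2 * adj ℤ H i j := by
    intro i j
    have := congrFun (congrFun hXAX i) j
    rw [Matrix.smul_apply, smul_eq_mul] at this
    rw [← this, Matrix.mul_assoc, Matrix.mul_apply']
    rfl
  have hdot : ∀ i j, Xᵀ i ⬝ᵥ Xᵀ j = (L : ℤ) ^ 2 * (1 : Matrix (Fin n) (Fin n) ℤ) i j := by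
    intro i j
    have := congrFun (congrFun hXX i) j
    rw [Matrix.smul_apply, smul_eq_mul] at this
    rw [← this, Matrix.mul_apply']
    rfl
  refine ⟨Xᵀ, fun i => ⟨fun p hp j => ?_, ?_, ?_, ?_⟩, ?_, fun i j hij => ⟨?_, ?_⟩⟩
  -- `W^(p)(G)ᵀ (L Q) = L W^(p)(H)ᵀ`, and `L` is a multiple of `p ^ t_p`.
  · have hWX : (modifiedWalkMatrix G p)ᵀ * X = (L : ℤ) • (modifiedWalkMatrix H p)ᵀ := by
      apply Matrix.map_injective hinj
      simp only [Matrix.map_mul, Matrix.transpose_map, hX, Matrix.mul_smul,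
        modifiedWalkMatrix_transpose_mul hcos.Mbar_eq p hAQ hQe]
      ext i j
      rw [Matrix.map_apply]
      simp only [Matrix.smul_apply, smul_eq_mul, map_mul]
      simp
    have h1 := congrFun (congrFun hWX j) i
    rw [Matrix.smul_apply, smul_eq_mul, Matrix.mul_apply'] at h1
    change _ ∣ (modifiedWalkMatrix G p)ᵀ j ⬝ᵥ fun k => X k i
    rw [h1]
    exact Dvd.dvd.mul_right (by exact_mod_cast pow_texp_dvd_level hn hG hp) _
  · rw [hdot, Matrix.one_apply_eq, mul_one]
  · rw [dotProduct_comm]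
    exact (congrFun hXe i).trans (by simp [hL])
  · rw [hform, adj_self, mul_zero]
  -- If all columns of `L Q` were divisible by `L`, then `Q` would be integral, hence a permutation
  -- matrix and an isomorphism.
  · by_contra! hall
    simp only [IsNontrivial, not_not] at hall
    choose P hP using hall
    have hXP : X = (L : ℤ) • (Matrix.of P)ᵀ := by
      ext i j
      exact hP j i
    have hQP : Q = (Matrix.of P)ᵀ.map (Int.castRingHom ℚ) := by
      ext i j
      have h1 := congrFun (congrFun hX i) j
      rw [hXP] at h1
      simp only [Matrix.map_apply, Matrix.smul_apply, smul_eq_mul, map_mul] at h1 ⊢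
      exact (mul_left_cancel₀ hLQ (by simpa using h1)).symm
    obtain ⟨e⟩ := nonempty_iso_of_integral (G := G) (H := H) (P := (Matrix.of P)ᵀ)
      (Matrix.map_injective hinj (by
        simp only [Matrix.map_mul, Matrix.transpose_map, ← hQP, hQQ]
        simp))
      (by
        ext i
        apply hinj
        rw [RingHom.map_mulVec, Matrix.transpose_map, ← hQP,
          show Int.castRingHom ℚ ∘ (1 : Fin n → ℤ) = 1 by ext; simp, hQe]
        simp)
      (Matrix.map_injective hinj (by
        simp only [Matrix.map_mul, Matrix.transpose_map, ← hQP, adj_map, hQAQ]))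
    exact hiso.elim e
  · rw [hdot, Matrix.one_apply_ne hij, mul_zero]
  · rw [hform, adj_eq_iff]
    split_ifs
    · exact Or.inr (mul_one _)
    · exact Or.inl (mul_zero _)

theorem spec_eq_of_conj {G H : SimpleGraph (Fin n)} {Q : Matrix (Fin n) (Fin n) ℚ}
    (hQQ : Q * Qᵀ = 1) (h : Qᵀ * adj ℚ G * Q = adj ℚ H) : spec G = spec H := by
  have hQ : (adj ℚ H).charpoly = (adj ℚ G).charpoly := by
    rw [← h, Matrix.charpoly_mul_comm, ← Matrix.mul_assoc, hQQ, Matrix.one_mul]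
  unfold spec
  rw [← adj_map G (algebraMap ℚ ℂ), ← adj_map H (algebraMap ℚ ℂ), Matrix.charpoly_map,
    Matrix.charpoly_map, hQ]

theorem submatrix_eq_of_iso (e : G ≃g H) :
    (adj ℚ G).submatrix e.symm e.symm = adj ℚ H := by
  classical
  ext i j
  rw [Matrix.submatrix_apply, adj_eq_iff, adj_eq_iff]
  simp only [e.symm.map_adj_iff]

theorem adj_pow_of_iso (e : G ≃g H) (k : ℕ) :
    adj ℚ H ^ k = (adj ℚ G ^ k).submatrix e.symm e.symm := by
  induction k with
  | zero => ext i j; simp [Matrix.one_apply]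
  | succ k ih =>
    rw [pow_succ, pow_succ, ih, ← submatrix_eq_of_iso e]
    exact Matrix.submatrix_mul_equiv _ _ _ e.symm.toEquiv _

theorem exists_mate_of_solutions (hG : Controllable G) {ξ : Fin n → Fin n → ℤ}
    (hsol : ∀ i, IsSolution G (ξ i)) (hnt : ∃ i, IsNontrivial G (ξ i))
    (horth : ∀ i j, i ≠ j → ξ i ⬝ᵥ ξ j = 0 ∧
      ξ i ⬝ᵥ (adj ℤ G *ᵥ ξ j) ∈ ({0, (level G : ℤ) ^ 2} : Set ℤ)) :
    ∃ H : SimpleGraph (Fin n), IsGeneralizedCospectralMate G H := by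
  classical
  have hL0 := (level_pos G).ne'
  generalize hL' : level G = L at hL0
  simp only [hL'] at horth
  have hLQ : (L : ℚ) ≠ 0 := by exact_mod_cast hL0
  have hLZ : (L : ℤ) ^ 2 ≠ 0 := by exact_mod_cast pow_ne_zero 2 hL0
  have hsymm : ∀ i j, ξ i ⬝ᵥ (adj ℤ G *ᵥ ξ j) = ξ j ⬝ᵥ (adj ℤ G *ᵥ ξ i) := by
    intro i j
    rw [Matrix.dotProduct_mulVec, ← Matrix.mulVec_transpose, (isSymm_adj G ℤ).eq, dotProduct_comm]
  -- The Gram matrix of the `ξ i` under `A`, divided by `L²`, is symmetric with entries 0 and 1 and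
  -- zero diagonal: it is the adjacency matrix of the mate.
  let H : SimpleGraph (Fin n) :=
    { Adj := fun i j => ξ i ⬝ᵥ (adj ℤ G *ᵥ ξ j) = (L : ℤ) ^ 2
      symm := ⟨fun i j h => by rw [hsymm]; exact h⟩
      loopless := ⟨fun i h => hLZ (h.symm.trans (hsol i).2.2.2)⟩ }
  have hform : ∀ i j, ξ i ⬝ᵥ (adj ℤ G *ᵥ ξ j) = (L : ℤ) ^ 2 * adj ℤ H i j := by
    intro i j
    rw [adj_eq_iff]
    split_ifs with h
    · rw [mul_one]; exact h
    · rw [mul_zero]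
      by_cases hij : i = j
      · subst hij; exact (hsol i).2.2.2
      · exact ((horth i j hij).2).resolve_right h
  have hdot : ∀ i j, ξ i ⬝ᵥ ξ j = (L : ℤ) ^ 2 * (1 : Matrix (Fin n) (Fin n) ℤ) i j := by
    intro i j
    by_cases hij : i = j
    · subst hij
      rw [(hsol i).2.1, Matrix.one_apply_eq, mul_one, hL']
    · rw [(horth i j hij).1, Matrix.one_apply_ne hij, mul_zero]
  set X : Matrix (Fin n) (Fin n) ℤ := (Matrix.of ξ)ᵀ with hX
  set Q : Matrix (Fin n) (Fin n) ℚ := (L : ℚ)⁻¹ • X.map (Int.castRingHom ℚ) with hQ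
  have hLL : (L : ℚ)⁻¹ * (L : ℚ)⁻¹ * (L : ℚ) ^ 2 = 1 := by field_simp
  have hscale : ∀ M N : Matrix (Fin n) (Fin n) ℤ, Xᵀ * M * X = (L : ℤ) ^ 2 • N →
      Qᵀ * M.map (Int.castRingHom ℚ) * Q = N.map (Int.castRingHom ℚ) := by
    intro M N h
    have h1 := congrArg (Matrix.map · (Int.castRingHom ℚ)) h
    simp only [Matrix.map_mul, Matrix.transpose_map] at h1
    rw [hQ, Matrix.transpose_smul, Matrix.smul_mul, Matrix.smul_mul, Matrix.mul_smul, h1, smul_smul]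
    ext i j
    simp only [Matrix.smul_apply, Matrix.map_apply, smul_eq_mul, map_mul, map_pow]
    rw [← mul_assoc, show Int.castRingHom ℚ (L : ℤ) = (L : ℚ) by simp, hLL, one_mul]
  have hQQ : Qᵀ * Q = 1 := by
    have h1 := hscale 1 1 (by
      rw [Matrix.mul_one]
      ext i j
      rw [Matrix.smul_apply, smul_eq_mul, ← hdot]
      rfl)
    rwa [Matrix.map_one _ (map_zero _) (map_one _), Matrix.mul_one] at h1
  have hQQ' : Q * Qᵀ = 1 := mul_eq_one_comm.mp hQQ
  have hQAQ : Qᵀ * adj ℚ G * Q = adj ℚ H := by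
    have h1 := hscale (adj ℤ G) (adj ℤ H) (by
      ext i j
      rw [Matrix.smul_apply, smul_eq_mul, ← hform, Matrix.mul_assoc]
      rfl)
    rwa [adj_map, adj_map] at h1
  have hQe : Qᵀ *ᵥ 1 = 1 := by
    ext i
    have h1 := congrArg (Int.cast : ℤ → ℚ) (hsol i).2.2.1
    rw [dotProduct_comm, hL'] at h1
    have h2 : (Qᵀ *ᵥ 1) i = (L : ℚ)⁻¹ * ((ξ i ⬝ᵥ 1 : ℤ) : ℚ) := by
      simp [hQ, hX, Matrix.mulVec, dotProduct, Finset.mul_sum]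
    rw [h2, h1]
    simp [hLQ]
  have hJ : Qᵀ * (Matrix.of fun _ _ => 1) * Q = Matrix.of fun _ _ => 1 := by
    rw [of_one_eq_vecMulVec, Matrix.mul_vecMulVec, Matrix.vecMulVec_mul, ← Matrix.mulVec_transpose, hQe]
  refine ⟨H, ⟨spec_eq_of_conj hQQ' hQAQ, spec_eq_of_conj hQQ' ?_⟩, ⟨fun e => ?_⟩⟩
  · rw [adj_compl, adj_compl, Matrix.mul_sub, Matrix.mul_sub, Matrix.sub_mul, Matrix.sub_mul, hJ,
      Matrix.mul_one, hQQ, hQAQ]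
  · obtain ⟨i, hi⟩ := hnt
    apply hi
    have hA : adj ℚ H * Qᵀ = Qᵀ * adj ℚ G := by
      rw [← hQAQ, Matrix.mul_assoc, hQQ', Matrix.mul_one]
    have hpow : ∀ k, Qᵀ * adj ℚ G ^ k = adj ℚ H ^ k * Qᵀ := by
      intro k
      have := aeval_mul_comm hA (Polynomial.X ^ k)
      simpa using this.symm
    -- Both `Qᵀ` and the permutation matrix of `e` send each `A^k 1` to the corresponding walk
    -- vector of `H`; these vectors span by controllability, so the two matrices agree.
    have hperm : Qᵀ = (1 : Matrix (Fin n) (Fin n) ℚ).submatrix e.symm id := by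
      refine eq_of_mul_walkMatrixRat hG fun k _ => ?_
      rw [Matrix.mulVec_mulVec, hpow, ← Matrix.mulVec_mulVec, hQe]
      rw [adj_pow_of_iso e]
      have h1 := Matrix.submatrix_mulVec_equiv (adj ℚ G ^ k) (1 : Fin n → ℚ) e.symm e.symm.toEquiv
      have h2 := Matrix.submatrix_mulVec_equiv (1 : Matrix (Fin n) (Fin n) ℚ)
        (adj ℚ G ^ k *ᵥ 1) e.symm (Equiv.refl _)
      rw [Equiv.refl_symm, Equiv.coe_refl, Function.comp_id, Matrix.one_mulVec] at h2
      rw [h2]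
      exact h1
    intro v
    have h2 := congrFun (congrFun hperm i) v
    rw [hL']
    refine ⟨(1 : Matrix (Fin n) (Fin n) ℤ) (e.symm i) v, ?_⟩
    have h3 : (L : ℚ)⁻¹ * (ξ i v : ℚ) = (1 : Matrix (Fin n) (Fin n) ℚ) (e.symm i) v := h2
    have h4 : (ξ i v : ℚ) = L * (1 : Matrix (Fin n) (Fin n) ℚ) (e.symm i) v := by
      rw [← h3, mul_inv_cancel_left₀ hLQ]
    rw [Matrix.one_apply] at h4 ⊢
    split_ifs at h4 ⊢ <;> exact_mod_cast h4

end Mates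

end GenSpec

theorem mainTheorem2 (n : ℕ) (G : SimpleGraph (Fin n)) (hG : GenSpec.Controllable G) :
    GenSpec.HasGeneralizedCospectralMate G ↔
      ∃ ξ : Fin n → Fin n → ℤ,
        (∀ i, GenSpec.IsSolution G (ξ i)) ∧
        (∃ i, GenSpec.IsNontrivial G (ξ i)) ∧
        ∀ i j, i ≠ j →
          ξ i ⬝ᵥ ξ j = 0 ∧
          ξ i ⬝ᵥ (GenSpec.adj ℤ G *ᵥ ξ j) ∈ ({0, (GenSpec.level G : ℤ) ^ 2} : Set ℤ) := by
  constructor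
  · rintro ⟨m, H, h⟩
    obtain rfl := h.1.eq_card
    exact GenSpec.exists_solutions_of_mate hG h
  · rintro ⟨ξ, hsol, hnt, horth⟩
    obtain ⟨H, hH⟩ := GenSpec.exists_mate_of_solutions hG hsol hnt horth
    exact ⟨n, H, hH⟩
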